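/- **Setting.** Let $G=(V,E)$ be a finite Eulerian plane triangulation: a finite plane graph, parallel edges allowed, in which every face (including the outer one) is bounded by a triangle and every vertex has even degree. Let $V=V_1\cup V_2\cup V_3$ be the tripartition given by a proper 3-colouring, $E=E_{12}\cup E_{13}\cup E_{23}$ the corresponding partition of the edges, and assume that every vertex of $V_3$ has degree $4$ or $6$. Let $G_{13}=(V_1\cup V_3,E_{13})$ and let $G_{13}^*$ be its plane dual. For $J\in\mathbb R$ put $$Z_{\rm HMBW}(G;J)=\sum_{\sigma\in\{\pm1\}^V}\exp\Big(J\sum_{\{i,j,k\}}\sigma_i\sigma_j\sigma_k\Big),$$ the inner sum being over all triangular faces of $G$. For a finite multigraph $H=(W,F)$ let $$Z_{\rm ICLAT}(H;L_2,L_2')=\lim_{L\to-\infty}\ \sum_{\sigma,\tau\in\{\pm1\}^W}\ \prod_{ij\in F}\exp\big[L_0+(L_2-L)\sigma_i\sigma_j+(L_2'-L)\tau_i\tau_j+L\,\sigma_i\sigma_j\tau_i\tau_j\big],$$ with the zero of energy $L_0=L-L_2-L_2'$, so that an edge has weight $1$ if $\sigma_i\sigma_j=\tau_i\tau_j=1$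 (and, in the limit, the weights $e^{-2L_2'},e^{-2L_2},0$ for $(\sigma_i\sigma_j,\tau_i\tau_j)=(1,-1),(-1,1),(-1,-1)$). **Statement.** (1) The vertices of $G_{13}^*$ are in bijection with $V_2$: every face of $G_{13}$ contains exactly one vertex of $V_2$. (2) Let $L_2,L_2'$ be couplings with $$e^{-2L_2}=\frac1{\cosh(2J)},\qquad e^{-2L_2'}=\tanh(2J).$$ They exist in $\mathbb C$ for every $J\neq0$; for $J>0$ there is exactly one real pair. Then the limit defining $Z_{\rm ICLAT}(G_{13}^*;L_2,L_2')$ exists and $$Z_{\rm HMBW}(G;J)=2^{-|V_2|+1}\,\big(2\cosh(2J)\big)^{|E_{13}|}\,Z_{\rm ICLAT}(G_{13}^*;L_2,L_2').$$ For $J=0$ this holds with $L_2=0$ and in the limit $L_2'\to+\infty$. Moreover $$\big(e^{-2L_2}\big)^2+\big(e^{-2L_2'}\big)^2=1 .$$ (3) If $H^{(2)}$ is a finite multigraph $H$ with every edge doubled, then $Z_{\rm ICLAT}(H^{(2)};L_2,L_2')=Z_{\rm ICLAT}(H;2L_2,2L_2')$; for couplings as in (2) the doubled couplings satisfy $e^{-2(2L_2)}+e^{-2(2L_2')}=1$.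 (4) For the infinite lattices, which are triangulations with all degrees even, there are tripartitions for which $G_{13}^*$, with vertex set $V_2$, is as follows: (a) $G$ triangular, all degrees $6$: $G_{13}^*$ is a triangular lattice; (b) $G$ union-jack, degrees $8,8,4$ on $V_1,V_2,V_3$: a square lattice with doubled edges; (c) $G$ bisected hexagonal, degrees $12,6,4$: a hexagonal lattice with doubled edges; (d) $G$ bisected hexagonal, degrees $6,12,4$: a triangular lattice with doubled edges; (e) $G$ bisected hexagonal, degrees $12,4,6$: a kagome lattice. Thus (2) maps these HMBW models to ICLAT models on the triangular and kagome lattices with couplings on the circle $(e^{-2L_2})^2+(e^{-2L_2'})^2=1$ in cases (a), (e), and, by (3), on the square, hexagonal and triangular lattices with (single-edge) couplings on the line $e^{-2L_2}+e^{-2L_2'}=1$ in cases (b), (c), (d). -/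

import Mathlib

/-! ### Combinatorial maps (graphs with a rotation system) -/

/-- A combinatorial map on a type `D` of darts (oriented edges), possibly with parallel edges.
`rev` reverses a dart, `rot d` is the next dart counterclockwise around the source of `d`. -/
structure CombMap (D : Type*) where
  rot : Equiv.Perm D
  rev : Equiv.Perm D
  rev_rev : ∀ d, rev (rev d) = d
  rev_ne : ∀ d, rev d ≠ d

namespace CombMap

variable {D : Type*} (M : CombMap D)

/-- Traversal of the face to the right of a dart. -/
def facePerm : Equiv.Perm D := M.rot * M.rev

/-- Vertices, edges and faces are the orbits of `rot`, `rev` and `facePerm`. -/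
def Vertex : Type _ := Quotient (Equiv.Perm.SameCycle.setoid M.rot)

def Edge : Type _ := Quotient (Equiv.Perm.SameCycle.setoid M.rev)

def Face : Type _ := Quotient (Equiv.Perm.SameCycle.setoid M.facePerm)

/-- The source of a dart. -/
def vert (d : D) : M.Vertex := Quotient.mk _ d

/-- The edge that carries a dart. -/
def edge (d : D) : M.Edge := Quotient.mk _ d

/-- The face to the right of a dart. -/
def face (d : D) : M.Face := Quotient.mk _ d

instance [Finite D] : Finite M.Vertex := inferInstanceAs (Finite (Quotient _))

instance [Finite D] : Finite M.Edge := inferInstanceAs (Finite (Quotient _))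

instance [Finite D] : Finite M.Face := inferInstanceAs (Finite (Quotient _))

noncomputable instance [Finite D] : Fintype M.Vertex := Fintype.ofFinite _

noncomputable instance [Finite D] : Fintype M.Edge := Fintype.ofFinite _

noncomputable instance [Finite D] : Fintype M.Face := Fintype.ofFinite _

theorem sameCycle_rev {a b : D} (h : M.rev.SameCycle a b) : b = a ∨ b = M.rev a := by
  obtain ⟨i, rfl⟩ := h
  have h2 : M.rev ^ (2 : ℤ) = 1 := by
    ext d
    rw [zpow_two]
    exact M.rev_rev d
  obtain ⟨k, rfl | rfl⟩ := Int.even_or_odd' i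
  · left; rw [zpow_mul, h2]; simp
  · right; rw [zpow_add, zpow_mul, h2]; simp

/-- The two endpoints of an edge. -/
def edgeEnds : M.Edge → Sym2 M.Vertex :=
  Quotient.lift (fun d => s(M.vert d, M.vert (M.rev d))) (by
    intro a b h
    rcases M.sameCycle_rev h with rfl | rfl
    · rfl
    · simp only [M.rev_rev]; exact Sym2.eq_swap)

/-- The faces on the two sides of an edge. -/
def edgeFaces : M.Edge → Sym2 M.Face :=
  Quotient.lift (fun d => s(M.face d, M.face (M.rev d))) (by
    intro a b h
    rcases M.sameCycle_rev h with rfl | rfl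
    · rfl
    · simp only [M.rev_rev]; exact Sym2.eq_swap)

/-- Number of darts that leave `v`, that is, the number of edges at `v` with multiplicity. -/
noncomputable def degree (v : M.Vertex) : ℕ := Nat.card {d : D // M.vert d = v}

/-- Connected, and of genus `0` by Euler's formula. -/
structure IsPlane : Prop where
  connected : MulAction.IsPretransitive (Subgroup.closure {M.rot, M.rev}) D
  euler : (Nat.card M.Vertex : ℤ) - Nat.card M.Edge + Nat.card M.Face = 2

/-- Every face is bounded by a triangle: there are no loops, and every face walk has length `3`
(hence visits three different vertices). -/
structure IsTriangulation : Prop where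
  loopless : ∀ d, M.vert d ≠ M.vert (M.rev d)
  triangle : ∀ d, M.facePerm d ≠ d ∧ M.facePerm (M.facePerm (M.facePerm d)) = d

/-- Every vertex has even degree. -/
def IsEulerian : Prop := ∀ v, Even (M.degree v)

/-- A proper colouring of the vertices. The colour classes `0, 1, 2` of a proper colouring
by `Fin 3` are the parts `V₁, V₂, V₃` of a tripartition. -/
def IsProper (c : M.Vertex → Fin 3) : Prop := ∀ d, c (M.vert d) ≠ c (M.vert (M.rev d))

/-- The edges that join a vertex of colour `i` to a vertex of colour `j`. -/
def edgesBetween (c : M.Vertex → Fin 3) (i j : Fin 3) : Set M.Edge :=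
  {e | (M.edgeEnds e).map c = s(i, j)}

/-- Two faces are merged when an edge between them is not in `S`. -/
def Merge (S : Set M.Edge) (f g : M.Face) : Prop :=
  ∃ d, M.edge d ∉ S ∧ M.face d = f ∧ M.face (M.rev d) = g

/-- The faces of the subgraph with edge set `S`, namely the unions of faces of `M` that are
connected to each other across edges which are not in `S`. -/
def SubFace (S : Set M.Edge) : Type _ := Quot (M.Merge S)

/-- The face of the subgraph with edge set `S` that contains the face `f` of `M`. -/
def subFace (S : Set M.Edge) (f : M.Face) : M.SubFace S := Quot.mk _ f

end CombMap

/-! ### Multigraphs -/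

/-- A graph in which loops and parallel edges are allowed. -/
structure Multigraph.{u} where
  V : Type u
  E : Type u
  ends : E → Sym2 V

namespace Multigraph

/-- Isomorphisms of multigraphs. -/
structure Iso (G H : Multigraph) where
  onV : G.V ≃ H.V
  onE : G.E ≃ H.E
  ends_eq : ∀ e, H.ends (onE e) = (G.ends e).map onV

/-- Every edge is replaced by two parallel edges. -/
def doubled (G : Multigraph) : Multigraph where
  V := G.V
  E := G.E × Bool
  ends := fun e => G.ends e.1

instance (G : Multigraph) [h : Fintype G.V] : Fintype G.doubled.V := h

instance (G : Multigraph) [Fintype G.E] : Fintype G.doubled.E :=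
  inferInstanceAs (Fintype (G.E × Bool))

/-- The product of the two Ising spins at the ends of an edge. -/
def bond (G : Multigraph) (s : G.V → ℤˣ) (e : G.E) : ℤ := (((G.ends e).map s).mul : ℤˣ)

/-- The Hamiltonian of the infinite-coupling-limit Ashkin--Teller model before the limit in `L`.
The additive constant `L - L₂ - L₂'` of each edge fixes the zero of energy so that an edge at
which both spins agree has Boltzmann weight `1`. -/
noncomputable def hamICLAT (G : Multigraph) [Fintype G.E] (L₂ L₂' : ℂ) (L : ℝ)
    (s t : G.V → ℤˣ) : ℂ :=
  -∑ e : G.E, ((L - L₂ - L₂') + (L₂ - L) * G.bond s e + (L₂' - L) * G.bond t e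
    + L * (G.bond s e * G.bond t e))

open Classical in
/-- The partition function at finite `L`. -/
noncomputable def preZICLAT (G : Multigraph) [Fintype G.V] [Fintype G.E] (L₂ L₂' : ℂ) (L : ℝ) :
    ℂ :=
  ∑ s : G.V → ℤˣ, ∑ t : G.V → ℤˣ, Complex.exp (-G.hamICLAT L₂ L₂' L s t)

/-- The partition function of the infinite-coupling-limit Ashkin--Teller model: `L → -∞` with
`L₂, L₂'` fixed. -/
noncomputable def ZICLAT (G : Multigraph) [Fintype G.V] [Fintype G.E] (L₂ L₂' : ℂ) : ℂ :=
  Filter.limUnder Filter.atBot (G.preZICLAT L₂ L₂')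

end Multigraph

namespace CombMap

variable {D : Type*} (M : CombMap D)

/-- The dual graph of the subgraph of `M` with edge set `S`: one vertex for each face of the
subgraph, and for each edge of the subgraph a dual edge joining the faces on its two sides. -/
def dualSub (S : Set M.Edge) : Multigraph where
  V := M.SubFace S
  E := S
  ends := fun e => (M.edgeFaces e).map (M.subFace S)

instance [Finite D] (S : Set M.Edge) : Finite (M.dualSub S).V :=
  inferInstanceAs (Finite (Quot _))

instance [Finite D] (S : Set M.Edge) : Finite (M.dualSub S).E :=
  inferInstanceAs (Finite (Subtype _))

noncomputable instance [Finite D] (S : Set M.Edge) : Fintype (M.dualSub S).V :=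
  Fintype.ofFinite _

noncomputable instance [Finite D] (S : Set M.Edge) : Fintype (M.dualSub S).E :=
  Fintype.ofFinite _

open Classical in
/-- The three-spin Hamiltonian: a sum over the faces of the product of the spins at the sources
of the darts that bound the face. -/
noncomputable def hamHMBW [Fintype D] (J : ℝ) (s : M.Vertex → ℤˣ) : ℝ :=
  -J * ∑ f : M.Face, (((∏ d with M.face d = f, s (M.vert d) : ℤˣ) : ℤ) : ℝ)

open Classical in
/-- The partition function of the Hintermann--Merlini--Baxter--Wu model. -/
noncomputable def ZHMBW [Fintype D] (J : ℝ) : ℝ :=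
  ∑ s : M.Vertex → ℤˣ, Real.exp (-M.hamHMBW J s)

end CombMap

/-! ### Lattices -/

/-- The darts of the triangulation obtained from a map on `D` by joining every vertex `v` to the
faces `f` around it, and by placing a new vertex `e` on every edge, joined to its two endpoints
and to its two faces. -/
inductive SubdivDart (D : Type*)
  /-- from the source of `d` to the midpoint of `d`, and back -/
  | ve (d : D)
  | ev (d : D)
  /-- from the face to the right of `d` to the midpoint of `d`, and back -/
  | fe (d : D)
  | ef (d : D)
  /-- from the source of `d` to the face to the right of `d`, and back -/
  | vf (d : D)
  | fv (d : D)

namespace CombMap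

variable {D : Type*}

open SubdivDart in
/-- The Eulerian triangulation on (vertices, faces, edges) of a map. -/
def subdiv (M : CombMap D) : CombMap (SubdivDart D) where
  rot :=
    { toFun := fun
        | ve d => vf (M.rot d)
        | vf d => ve d
        | ev d => ef d
        | ef d => ev (M.rev d)
        | fe d => fv d
        | fv d => fe (M.facePerm.symm d)
      invFun := fun
        | vf d => ve (M.rot.symm d)
        | ve d => vf d
        | ef d => ev d
        | ev d => ef (M.rev d)
        | fv d => fe d
        | fe d => fv (M.facePerm d)
      left_inv := by intro x; cases x <;> simp [M.rev_rev]
      right_inv := by intro x; cases x <;> simp [M.rev_rev] }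
  rev :=
    { toFun := fun
        | ve d => ev d
        | ev d => ve d
        | fe d => ef d
        | ef d => fe d
        | vf d => fv d
        | fv d => vf d
      invFun := fun
        | ve d => ev d
        | ev d => ve d
        | fe d => ef d
        | ef d => fe d
        | vf d => fv d
        | fv d => vf d
      left_inv := by intro x; cases x <;> rfl
      right_inv := by intro x; cases x <;> rfl }
  rev_rev := by intro x; cases x <;> rfl
  rev_ne := by intro x; cases x <;> simp

/-- The map on `ℤ × ℤ` in which the darts at each site point, counterclockwise, to the sites at
`dir 0, …, dir (n - 1)`, and `k + m` is the direction opposite to `k`. -/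
def ofDirections {n : ℕ} [NeZero n] (dir : Fin n → ℤ × ℤ) (m : Fin n)
    (hm : m + m = 0) (hm0 : m ≠ 0) (hdir : ∀ k, dir (k + m) = -dir k) :
    CombMap ((ℤ × ℤ) × Fin n) where
  rot := Equiv.prodCongr (Equiv.refl _) (Equiv.addRight 1)
  rev :=
    { toFun := fun p => (p.1 + dir p.2, p.2 + m)
      invFun := fun p => (p.1 + dir p.2, p.2 + m)
      left_inv := by rintro ⟨v, k⟩; simp [hdir, add_assoc, hm]
      right_inv := by rintro ⟨v, k⟩; simp [hdir, add_assoc, hm] }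
  rev_rev := by rintro ⟨v, k⟩; simp [hdir, add_assoc, hm]
  rev_ne := by
    rintro ⟨v, k⟩ h
    simp only [Equiv.coe_fn_mk, Prod.mk.injEq] at h
    exact hm0 (by simpa using h.2)

/-- The square lattice. -/
def square : CombMap ((ℤ × ℤ) × Fin 4) :=
  ofDirections ![(1, 0), (0, 1), (-1, 0), (0, -1)] 2 (by decide) (by decide) (by decide)

/-- The triangular lattice, in the basis of two unit vectors at an angle of 60 degrees. -/
def triangular : CombMap ((ℤ × ℤ) × Fin 6) :=
  ofDirections ![(1, 0), (0, 1), (-1, 1), (-1, 0), (0, -1), (1, -1)] 3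
    (by decide) (by decide) (by decide)

/-- The union-jack lattice. -/
def unionJack : CombMap (SubdivDart ((ℤ × ℤ) × Fin 4)) := square.subdiv

/-- The bisected hexagonal lattice. -/
def bisectedHexagonal : CombMap (SubdivDart ((ℤ × ℤ) × Fin 6)) := triangular.subdiv

end CombMap

namespace Multigraph

/-- The square lattice. -/
def squareLattice : Multigraph where
  V := ℤ × ℤ
  E := (ℤ × ℤ) × Fin 2
  ends := fun e => s(e.1, e.1 + ![(1, 0), (0, 1)] e.2)

/-- The triangular lattice. -/
def triangularLattice : Multigraph where
  V := ℤ × ℤ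
  E := (ℤ × ℤ) × Fin 3
  ends := fun e => s(e.1, e.1 + ![(1, 0), (0, 1), (-1, 1)] e.2)

/-- The hexagonal lattice, with a two-point basis. -/
def hexagonalLattice : Multigraph where
  V := (ℤ × ℤ) × Bool
  E := (ℤ × ℤ) × Fin 3
  ends := fun e => s((e.1, false), (e.1 - ![(0, 0), (1, 0), (0, 1)] e.2, true))

/-- The `k`-th corner of the upward (`true`) or downward (`false`) triangle number `v` of the
kagome lattice. The site `(v, k)` is placed at `v`, `v + (1/2, 0)`, `v + (0, 1/2)`. -/
def kagomeCorner (v : ℤ × ℤ) (up : Bool) (k : Fin 3) : (ℤ × ℤ) × Fin 3 :=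
  if up then (v, k) else (v - ![(0, 0), (1, 0), (0, 1)] k, k)

/-- The kagome lattice, with a three-point basis. The edges are the sides of the triangles, each
given by the opposite corner. -/
def kagomeLattice : Multigraph where
  V := (ℤ × ℤ) × Fin 3
  E := ((ℤ × ℤ) × Bool) × Fin 3
  ends := fun e => s(kagomeCorner e.1.1 e.1.2 (e.2 + 1), kagomeCorner e.1.1 e.1.2 (e.2 + 2))

end Multigraph

/-- `M` is a triangulation with all degrees even that has a tripartition `V₁, V₂, V₃` in which all
vertices of `Vᵢ` have degree `nᵢ`, and the dual graph of `G₁₃` is `H`, with vertex set `V₂`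
(a vertex of `V₂` corresponds to the face of `G₁₃` that contains it). -/
def CombMap.HasLatticeDual {D : Type*} (M : CombMap D) (n₁ n₂ n₃ : ℕ) (H : Multigraph) : Prop :=
  M.IsTriangulation ∧ M.IsEulerian ∧
  ∃ c : M.Vertex → Fin 3, M.IsProper c ∧ (∀ v, M.degree v = ![n₁, n₂, n₃] (c v)) ∧
    ∃ (φ : (M.dualSub (M.edgesBetween c 0 2)).Iso H) (β : {v : M.Vertex // c v = 1} ≃ H.V),
      ∀ (d : D) (hd : c (M.vert d) = 1),
        φ.onV (M.subFace (M.edgesBetween c 0 2) (M.face d)) = β ⟨M.vert d, hd⟩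

/-! ### Orbits of permutations -/

/-! Every triangle has exactly one side in `E₁₃`, and every edge of `E₁₃` borders two triangles. The
energy is therefore a sum over `E₁₃` of `σσ'(τ + τ')`, with `σ` on `V₁ ∪ V₃` and `τ` the spins on
`V₂` on the two sides of the edge (`crossFace_bijective`, `sum_faces_eq_sum_cross`). Removing the
edges outside `E₁₃` merges the triangles around each vertex of `V₂` into one face, so `V₂` is the
vertex set of the dual (`starFaceEquiv`).

For fixed `τ`, a high-temperature expansion in `σ` leaves a sum over even subgraphs of `G₁₃`: an
edge has weight `cosh 2J` or `τ sinh 2J` if `τ = τ'`, and `1` or `0` if `τ ≠ τ'`. Each set of domain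
walls of spins `s` on `V₂` is an even subgraph and comes from exactly two configurations; counting
with Euler's formula shows that there are no other even subgraphs (`sum_even_subgraphs`). Dividing
by `cosh 2J` gives the weights `1`, `tanh 2J`, `1 / cosh 2J`, `0` of the Ashkin--Teller limit, up to
the product of the signs `τ` over the walls.

This product is trivial by the degree condition (`prod_signPair_eq_one`). A vertex of `V₃` meets two
or three edges of `E₁₃`, and zero or two of them are walls. Nonzero weight forces `τ = τ'` across a
wall, so with at most three neighbours in `V₂` the two walls carry equal signs. At degree `8` two
opposite walls could carry different signs.

For the lattices, a vertex of `V₂` and an edge of `E₁₃` are read off from darts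
(`HasLatticeDual.of_darts`). The union-jack and bisected hexagonal lattices are subdivisions of the
square and triangular lattices, and the three choices of `V₂` (vertices, faces, edges) give the
doubled map, the doubled dual and the medial graph. Functions on vertices and faces are obtained
throughout from functions on darts that are invariant under one step of the permutation. -/

theorem Equiv.Perm.SameCycle.apply_eq {α β : Type*} {σ : Equiv.Perm α} {f : α → β}
    (hf : ∀ a, f (σ a) = f a) {a b : α} (h : σ.SameCycle a b) : f a = f b := by
  obtain ⟨i, rfl⟩ := h
  have hf' : ∀ a, f (σ⁻¹ a) = f a := fun a => by
    rw [← hf (σ⁻¹ a)]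
    exact congrArg f (σ.apply_symm_apply a)
  induction i with
  | zero => simp
  | succ i ih => rw [add_comm, zpow_add, zpow_one, Equiv.Perm.mul_apply, hf, ← ih]
  | pred i ih =>
    rw [sub_eq_neg_add, zpow_add, zpow_neg_one, Equiv.Perm.mul_apply, hf', ← ih]

/-- The orbit of a periodic point of a permutation has as many elements as its period. -/
theorem Equiv.Perm.bijective_iterate_sameCycle {α : Type*} (σ : Equiv.Perm α) {a : α}
    (ha : 0 < Function.minimalPeriod σ a) :
    Function.Bijective fun i : Fin (Function.minimalPeriod σ a) =>
      (⟨σ^[i] a, ⟨(i : ℕ), by rw [zpow_natCast, Equiv.Perm.iterate_eq_pow]⟩⟩ :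
        {b // σ.SameCycle a b}) := by
  constructor
  · intro i j h
    have := Function.iterate_injOn_Iio_minimalPeriod (f := σ) (x := a) i.2 j.2
      (Subtype.ext_iff.1 h)
    exact Fin.ext this
  · rintro ⟨b, hb⟩
    -- Membership in an orbit allows negative exponents. Being reachable by forward iteration is
    -- invariant under `σ`, by periodicity, so it holds on the whole orbit.
    have hfin : ∃ i : ℕ, σ^[i] a = b := by
      have key : ∀ b, (∃ i : ℕ, σ^[i] a = b) = (∃ i : ℕ, σ^[i] a = σ b) := by
        intro b
        apply propext
        constructor
        · rintro ⟨i, rfl⟩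
          exact ⟨i + 1, Function.iterate_succ_apply' _ _ _⟩
        · rintro ⟨i, hi⟩
          rcases i with _ | i
          -- Here `σ b = a`, so `b` precedes `a` and is reached after one step less than a full
          -- period.
          · refine ⟨Function.minimalPeriod σ a - 1, σ.injective ?_⟩
            rw [← Function.iterate_succ_apply' σ, Nat.succ_eq_add_one, Nat.sub_add_cancel ha,
              Function.iterate_minimalPeriod]
            exact hi
          · exact ⟨i, σ.injective (by rw [← hi, Function.iterate_succ_apply'])⟩
      have := hb.apply_eq (f := fun b => ∃ i : ℕ, σ^[i] a = b) (fun b => (key b).symm)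
      exact this ▸ ⟨0, rfl⟩
    obtain ⟨i, rfl⟩ := hfin
    refine ⟨⟨i % Function.minimalPeriod σ a, Nat.mod_lt _ ha⟩, Subtype.ext ?_⟩
    exact Function.iterate_mod_minimalPeriod_eq

namespace CombMap

variable {D : Type*} (M : CombMap D)

/-! ### Vertices, edges and faces as orbits of darts -/

theorem vert_eq_iff {a b : D} : M.vert a = M.vert b ↔ M.rot.SameCycle a b := Quotient.eq

theorem face_eq_iff {a b : D} : M.face a = M.face b ↔ M.facePerm.SameCycle a b := Quotient.eq

theorem edge_eq_iff {a b : D} : M.edge a = M.edge b ↔ b = a ∨ b = M.rev a := by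
  constructor
  · exact fun h => M.sameCycle_rev (Quotient.exact h)
  · rintro (rfl | rfl)
    · rfl
    · exact Quotient.sound ⟨1, by simp⟩

theorem vert_surjective : Function.Surjective M.vert := Quotient.mk_surjective

theorem edge_surjective : Function.Surjective M.edge := Quotient.mk_surjective

theorem face_surjective : Function.Surjective M.face := Quotient.mk_surjective

@[simp] theorem vert_rot (d : D) : M.vert (M.rot d) = M.vert d :=
  (M.vert_eq_iff.2 ⟨1, by simp⟩).symm

@[simp] theorem edge_rev (d : D) : M.edge (M.rev d) = M.edge d :=
  (M.edge_eq_iff.2 (Or.inr rfl)).symm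

@[simp] theorem face_facePerm (d : D) : M.face (M.facePerm d) = M.face d :=
  (M.face_eq_iff.2 ⟨1, by simp⟩).symm

theorem facePerm_apply (d : D) : M.facePerm d = M.rot (M.rev d) := rfl

@[simp] theorem vert_facePerm (d : D) : M.vert (M.facePerm d) = M.vert (M.rev d) :=
  M.vert_rot _

/-- The two darts bound the same corner at the source of `d`: `facePerm` takes `rev d` to `rot d`.
-/
theorem face_rev (d : D) : M.face (M.rev d) = M.face (M.rot d) := by
  rw [← face_facePerm, facePerm_apply, M.rev_rev]

@[simp] theorem vert_rot_symm (d : D) : M.vert (M.rot.symm d) = M.vert d := by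
  rw [← M.vert_rot, Equiv.apply_symm_apply]

theorem degree_vert (d : D) (hd : 0 < Function.minimalPeriod M.rot d) :
    M.degree (M.vert d) = Function.minimalPeriod M.rot d := by
  have h := Nat.card_congr (Equiv.ofBijective _ (M.rot.bijective_iterate_sameCycle hd))
  rw [Nat.card_fin] at h
  rw [h]
  exact Nat.card_congr (Equiv.subtypeEquivRight fun b => by rw [eq_comm, vert_eq_iff])

theorem mem_edgesBetween {c : M.Vertex → Fin 3} {i j : Fin 3} {d : D} :
    M.edge d ∈ M.edgesBetween c i j ↔
      (c (M.vert d) = i ∧ c (M.vert (M.rev d)) = j) ∨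
        (c (M.vert d) = j ∧ c (M.vert (M.rev d)) = i) := by
  change Sym2.map c s(M.vert d, M.vert (M.rev d)) = s(i, j) ↔ _
  rw [Sym2.map_mk, Sym2.eq_iff]

/-! ### Properly coloured triangulations and the faces of `G₁₃` -/

section Triangulation

variable {M} {c : M.Vertex → Fin 3}

theorem IsTriangulation.facePerm_facePerm (hT : M.IsTriangulation) (d : D) :
    M.facePerm (M.facePerm d) = M.rev (M.rot.symm d) := by
  have h := (hT.triangle d).2
  rw [facePerm_apply M (M.facePerm (M.facePerm d))] at h
  rw [(Equiv.symm_apply_eq _).2 h.symm, M.rev_rev]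

/-- The three vertices of a face have three different colours. -/
theorem IsProper.face_colours (hc : M.IsProper c) (hT : M.IsTriangulation) (d : D) :
    c (M.vert d) ≠ c (M.vert (M.rev d)) ∧
      c (M.vert (M.rev d)) ≠ c (M.vert (M.rev (M.facePerm d))) ∧
      c (M.vert (M.rev (M.facePerm d))) ≠ c (M.vert d) := by
  refine ⟨hc d, ?_, ?_⟩
  · have := hc (M.facePerm d)
    rwa [vert_facePerm] at this
  · have := hc (M.facePerm (M.facePerm d))
    rw [vert_facePerm] at this
    rwa [hT.facePerm_facePerm, M.rev_rev, vert_rot_symm] at this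

variable (M c) in
/-- The vertex of colour `1` of the face to the right of a dart. -/
def mid (d : D) : M.Vertex :=
  if c (M.vert d) = 1 then M.vert d
  else if c (M.vert (M.rev d)) = 1 then M.vert (M.rev d)
  else M.vert (M.rev (M.facePerm d))

theorem IsProper.colour_mid (hc : M.IsProper c) (hT : M.IsTriangulation) (d : D) :
    c (M.mid c d) = 1 := by
  obtain ⟨h1, h2, h3⟩ := hc.face_colours hT d
  unfold mid
  split_ifs <;> first | assumption | omega

theorem mid_of_vert {d : D} (h : c (M.vert d) = 1) : M.mid c d = M.vert d := if_pos h

theorem IsProper.mid_of_vert_rev (hc : M.IsProper c) {d : D} (h : c (M.vert (M.rev d)) = 1) :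
    M.mid c d = M.vert (M.rev d) := by
  rw [mid, if_neg (fun h' => hc d (h'.trans h.symm)), if_pos h]

theorem IsProper.mid_facePerm (hc : M.IsProper c) (hT : M.IsTriangulation) (d : D) :
    M.mid c (M.facePerm d) = M.mid c d := by
  obtain ⟨h1, h2, h3⟩ := hc.face_colours hT d
  have h := hT.facePerm_facePerm d
  have e : M.vert (M.rev (M.facePerm (M.facePerm d))) = M.vert d := by
    rw [h, M.rev_rev, vert_rot_symm]
  unfold mid
  rw [vert_facePerm, e]
  split_ifs <;> first | rfl | (exfalso; omega)

theorem IsProper.mid_rot (hc : M.IsProper c) (hT : M.IsTriangulation) (d : D) :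
    M.mid c (M.rot d) = M.mid c (M.rev d) := by
  rw [← hc.mid_facePerm hT (M.rev d), facePerm_apply, M.rev_rev]

theorem IsProper.mid_eq_of_face_eq (hc : M.IsProper c) (hT : M.IsTriangulation) {a b : D}
    (h : M.face a = M.face b) : M.mid c a = M.mid c b :=
  (M.face_eq_iff.1 h).apply_eq (hc.mid_facePerm hT)

/-- An edge outside `E₁₃` has an end of colour `1`, and this end is a corner of both adjacent
triangles. Hence `mid` survives the merging of faces. -/
theorem IsProper.mid_rev (hc : M.IsProper c) {d : D}
    (h : M.edge d ∉ M.edgesBetween c 0 2) : M.mid c (M.rev d) = M.mid c d := by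
  rw [mem_edgesBetween] at h
  have h1 := hc d
  by_cases h2 : c (M.vert d) = 1
  · rw [mid_of_vert h2, hc.mid_of_vert_rev (by rwa [M.rev_rev]), M.rev_rev]
  · have h3 : c (M.vert (M.rev d)) = 1 := by omega
    rw [hc.mid_of_vert_rev h3, mid_of_vert h3]

theorem IsProper.not_mem_edgesBetween (hc : M.IsProper c) {d : D} (hd : c (M.vert d) = 1) :
    M.edge d ∉ M.edgesBetween c 0 2 := by
  have := hc d
  rw [mem_edgesBetween]
  omega

/-- Consecutive triangles around a vertex of colour `1` are separated by an edge outside `E₁₃`, so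
they are merged. -/
theorem IsProper.subFace_rot (hc : M.IsProper c) {d : D} (hd : c (M.vert d) = 1) :
    M.subFace (M.edgesBetween c 0 2) (M.face (M.rot d)) =
      M.subFace (M.edgesBetween c 0 2) (M.face d) := by
  rw [← face_rev]
  exact (Quot.sound ⟨d, hc.not_mem_edgesBetween hd, rfl, rfl⟩).symm

variable (M c) in
/-- The face of the subgraph `E₁₃` around a vertex of colour `1`. -/
noncomputable def starFace (v : {v : M.Vertex // c v = 1}) :
    (M.dualSub (M.edgesBetween c 0 2)).V :=
  M.subFace _ (M.face (M.vert_surjective v.1).choose)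

theorem IsProper.starFace_vert (hc : M.IsProper c) (d : D) (hd : c (M.vert d) = 1) :
    M.starFace c ⟨M.vert d, hd⟩ = M.subFace (M.edgesBetween c 0 2) (M.face d) := by
  have h := (M.vert_surjective (M.vert d)).choose_spec
  -- The subface is invariant under rotation only at darts of colour `1`. The value `none` elsewhere
  -- makes the function invariant on all darts.
  have key := (M.vert_eq_iff.1 h.symm).apply_eq
    (f := fun d => if c (M.vert d) = 1 then
      some (M.subFace (M.edgesBetween c 0 2) (M.face d)) else none) (by
      intro a
      rw [vert_rot]
      split_ifs with ha
      · rw [hc.subFace_rot ha]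
      · rfl)
  simp only [h, if_pos hd] at key
  exact (Option.some.inj key).symm

/-- Every face of the subgraph `E₁₃` contains exactly one vertex of colour `1`. -/
noncomputable def starFaceEquiv (hc : M.IsProper c) (hT : M.IsTriangulation) :
    {v : M.Vertex // c v = 1} ≃ (M.dualSub (M.edgesBetween c 0 2)).V where
  toFun := M.starFace c
  invFun := Quot.lift
    (Quotient.lift (fun d => ⟨M.mid c d, hc.colour_mid hT d⟩) (fun a b h =>
      Subtype.ext (hc.mid_eq_of_face_eq hT (M.face_eq_iff.2 h))))
    (by
      rintro f g ⟨d, hd, rfl, rfl⟩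
      exact Subtype.ext (hc.mid_rev hd).symm)
  left_inv := by
    rintro ⟨v, hv⟩
    obtain ⟨d, rfl⟩ := M.vert_surjective v
    rw [hc.starFace_vert d hv]
    exact Subtype.ext (mid_of_vert hv)
  right_inv := by
    rintro ⟨⟨d⟩⟩
    suffices h : ∀ d, M.starFace c ⟨M.mid c d, hc.colour_mid hT d⟩ =
        M.subFace (M.edgesBetween c 0 2) (M.face d) from h d
    intro d
    have h0 := hc.colour_mid hT d
    -- It suffices to find on the boundary of the triangle a dart that starts at its corner of
    -- colour `1`; it is `d` or one of the next two darts.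
    have hs : ∀ a (ha : c (M.vert a) = 1), M.face a = M.face d →
        M.starFace c ⟨M.mid c d, h0⟩ = M.subFace (M.edgesBetween c 0 2) (M.face d) := by
      intro a ha hf
      rw [← hf, ← hc.starFace_vert a ha]
      congr 2
      rw [← hc.mid_eq_of_face_eq hT hf, mid_of_vert ha]
    obtain ⟨h1, h2, h3⟩ := hc.face_colours hT d
    by_cases e1 : c (M.vert d) = 1
    · exact hs d e1 rfl
    by_cases e2 : c (M.vert (M.rev d)) = 1
    · exact hs (M.facePerm d) (by rwa [vert_facePerm]) (M.face_facePerm d)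
    · exact hs (M.facePerm (M.facePerm d)) (by rw [vert_facePerm]; omega)
        (by rw [face_facePerm, face_facePerm])

theorem starFaceEquiv_mid (hc : M.IsProper c) (hT : M.IsTriangulation) (d : D) :
    starFaceEquiv hc hT ⟨M.mid c d, hc.colour_mid hT d⟩ =
      M.subFace (M.edgesBetween c 0 2) (M.face d) :=
  (starFaceEquiv hc hT).right_inv (M.subFace _ (M.face d))

variable (M c) in
/-- The darts from colour `2` to colour `0`, one for each edge between these colours. -/
abbrev CrossDart : Type _ := {d : D // c (M.vert d) = 2 ∧ c (M.vert (M.rev d)) = 0}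

variable (M c) in
/-- The edges between the colours `0` and `2` as darts from `2` to `0`. -/
noncomputable def crossEquiv : M.CrossDart c ≃ M.edgesBetween c 0 2 :=
  Equiv.ofBijective
    (fun d => ⟨M.edge d.1, M.mem_edgesBetween.2 (Or.inr d.2)⟩) (by
      constructor
      · rintro ⟨a, ha⟩ ⟨b, hb⟩ h
        rcases M.edge_eq_iff.1 (Subtype.ext_iff.1 h) with rfl | rfl
        · rfl
        · exact absurd (ha.2.symm.trans hb.1) (by decide)
      · rintro ⟨e, he⟩
        obtain ⟨d, rfl⟩ := M.edge_surjective e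
        rcases M.mem_edgesBetween.1 he with h | h
        · exact ⟨⟨M.rev d, h.2, by rw [M.rev_rev]; exact h.1⟩, Subtype.ext (M.edge_rev d)⟩
        · exact ⟨⟨d, h⟩, rfl⟩)

theorem dualSub_ends_crossEquiv (hc : M.IsProper c) (hT : M.IsTriangulation)
    (d : M.CrossDart c) :
    (M.dualSub (M.edgesBetween c 0 2)).ends (M.crossEquiv c d) =
      s(starFaceEquiv hc hT ⟨M.mid c d, hc.colour_mid hT d⟩,
        starFaceEquiv hc hT ⟨M.mid c (M.rev d), hc.colour_mid hT _⟩) := by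
  rw [starFaceEquiv_mid, starFaceEquiv_mid]
  rfl

end Triangulation

end CombMap

/-! ### Ising spins: high-temperature expansion and duality -/

section Spins

/-- The bicharacter of `{±1}`. -/
def signPair (x y : ℤˣ) : ℤˣ := if x = 1 then 1 else y

theorem signPair_mul_left : ∀ x x' y, signPair (x * x') y = signPair x y * signPair x' y := by
  decide

theorem signPair_mul_right : ∀ x y y', signPair x (y * y') = signPair x y * signPair x y' := by
  decide

theorem sign_mul_eq_one_iff : ∀ x y : ℤˣ, x * y = 1 ↔ x = y := by decide

theorem signPair_one_left : ∀ y, signPair 1 y = 1 := by decide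

theorem signPair_prod_left {ι : Type*} (s : Finset ι) (x : ι → ℤˣ) (y : ℤˣ) :
    signPair (∏ i ∈ s, x i) y = ∏ i ∈ s, signPair (x i) y := by
  classical
  induction s using Finset.induction_on with
  | empty => exact signPair_one_left y
  | insert i s hi ih => rw [Finset.prod_insert hi, Finset.prod_insert hi, signPair_mul_left, ih]

theorem sum_signs {R : Type*} [AddCommMonoid R] (f : ℤˣ → R) : ∑ x, f x = f 1 + f (-1) := by
  rw [show (Finset.univ : Finset ℤˣ) = {1, -1} from by decide]
  exact Finset.sum_pair (by decide)

theorem sum_signPair_right (x : ℤˣ) : ∑ y, ((signPair x y : ℤ) : ℝ) = if x = 1 then 2 else 0 := by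
  rw [sum_signs]
  rcases Int.units_eq_one_or x with rfl | rfl <;> norm_num [signPair]

theorem sum_signPair_left (y : ℤˣ) : ∑ x, ((signPair x y : ℤ) : ℝ) = if y = 1 then 2 else 0 := by
  rw [sum_signs]
  rcases Int.units_eq_one_or y with rfl | rfl <;> norm_num [signPair]

variable {U W A : Type*} [Fintype U] [Fintype W] [Fintype A]
  [DecidableEq U] [DecidableEq W]

/-- The boundary of a set of edges, where an edge `a` joins `i a` to `k a`. -/
def spinBoundary (i k : A → U) (ε : A → ℤˣ) (u : U) : ℤˣ :=
  (∏ a, if i a = u then ε a else 1) * ∏ a, if k a = u then ε a else 1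

/-- The domain walls of a spin configuration. -/
def spinCut (p q : A → W) (s : W → ℤˣ) (a : A) : ℤˣ := s (p a) * s (q a)

/-- A summation by parts: under the bimultiplicative pairing, the boundary map is adjoint to the map
that takes spins to their products along edges. -/
theorem prod_signPair_boundary (i k : A → U) (ε : A → ℤˣ) (σ : U → ℤˣ) :
    ∏ u, signPair (spinBoundary i k ε u) (σ u) = ∏ a, signPair (ε a) (σ (i a) * σ (k a)) := by
  have h : ∀ j : A → U, ∏ u, signPair (∏ a, if j a = u then ε a else 1) (σ u) =
      ∏ a, signPair (ε a) (σ (j a)) := by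
    intro j
    simp_rw [signPair_prod_left]
    rw [Finset.prod_comm]
    refine Finset.prod_congr rfl fun a _ => ?_
    rw [Finset.prod_eq_single (j a)]
    · rw [if_pos rfl]
    · intro u _ hu
      rw [if_neg (Ne.symm hu), signPair_one_left]
    · exact fun h => absurd (Finset.mem_univ _) h
  simp_rw [spinBoundary, signPair_mul_left, signPair_mul_right, Finset.prod_mul_distrib, h]

/-- Grouped by vertices, the sum factorizes over `U`, and orthogonality of characters gives a factor
`2` or `0` at each vertex. -/
theorem sum_prod_signPair_spins (i k : A → U) (ε : A → ℤˣ) :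
    ∑ σ : U → ℤˣ, ∏ a, ((signPair (ε a) (σ (i a) * σ (k a)) : ℤ) : ℝ) =
      if spinBoundary i k ε = 1 then 2 ^ Fintype.card U else 0 := by
  have h : ∀ σ : U → ℤˣ, ∏ a, ((signPair (ε a) (σ (i a) * σ (k a)) : ℤ) : ℝ) =
      ∏ u, ((signPair (spinBoundary i k ε u) (σ u) : ℤ) : ℝ) := by
    intro σ
    have := congrArg (fun x : ℤˣ => ((x : ℤ) : ℝ)) (prod_signPair_boundary i k ε σ)
    simp only [Units.coe_prod, Int.cast_prod] at this
    exact this.symm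
  simp_rw [h]
  rw [← Fintype.prod_sum (fun u x => ((signPair (spinBoundary i k ε u) x : ℤ) : ℝ))]
  simp_rw [sum_signPair_right]
  split_ifs with hε
  · simp [hε]
  · obtain ⟨u, hu⟩ := Function.ne_iff.1 hε
    exact Finset.prod_eq_zero (Finset.mem_univ u) (if_neg hu)

/-- Constant configurations of spins. -/
theorem card_constant_spins {X : Type*} [Fintype X] [DecidableEq X] [Nonempty X]
    (P : (X → ℤˣ) → Prop) [DecidablePred P] (hP : ∀ s, P s ↔ ∀ x y, s x = s y) :
    (Finset.univ.filter P).card = 2 := by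
  have : Finset.univ.filter P = {fun _ => 1, fun _ => -1} := by
    ext s
    simp only [Finset.mem_filter, Finset.mem_univ, true_and, Finset.mem_insert,
      Finset.mem_singleton, hP]
    constructor
    · intro h
      obtain ⟨x⟩ := ‹Nonempty X›
      rcases Int.units_eq_one_or (s x) with h1 | h1
      · exact Or.inl (funext fun y => (h y x).trans h1)
      · exact Or.inr (funext fun y => (h y x).trans h1)
    · rintro (rfl | rfl) <;> intros <;> rfl
  rw [this]
  refine Finset.card_pair fun h => ?_
  obtain ⟨x⟩ := ‹Nonempty X›
  exact absurd (congrFun h x) (by decide)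

/-- The number of even subgraphs of a connected graph. -/
theorem card_even_subgraphs [DecidableEq A] [Nonempty U] (i k : A → U)
    (hU : ∀ σ : U → ℤˣ, (∀ a, σ (i a) = σ (k a)) → ∀ x y, σ x = σ y) :
    (Finset.univ.filter fun ε => spinBoundary i k ε = 1).card * 2 ^ Fintype.card U =
      2 * 2 ^ Fintype.card A := by
  -- The same double sum is evaluated in both orders: summing over `σ` first selects the even
  -- subgraphs, summing over `ε` first selects the two constant configurations.
  have h1 : ∑ ε : A → ℤˣ, ∑ σ : U → ℤˣ, ∏ a, ((signPair (ε a) (σ (i a) * σ (k a)) : ℤ) : ℝ) =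
      (Finset.univ.filter fun ε => spinBoundary i k ε = 1).card * 2 ^ Fintype.card U := by
    simp_rw [sum_prod_signPair_spins]
    rw [← Finset.sum_filter, Finset.sum_const, nsmul_eq_mul]
  have h2 : ∑ σ : U → ℤˣ, ∑ ε : A → ℤˣ, ∏ a, ((signPair (ε a) (σ (i a) * σ (k a)) : ℤ) : ℝ) =
      2 * 2 ^ Fintype.card A := by
    have : ∀ σ : U → ℤˣ, ∑ ε : A → ℤˣ, ∏ a, ((signPair (ε a) (σ (i a) * σ (k a)) : ℤ) : ℝ) =
        if ∀ a, σ (i a) = σ (k a) then 2 ^ Fintype.card A else 0 := by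
      intro σ
      rw [← Fintype.prod_sum (fun a x => ((signPair x (σ (i a) * σ (k a)) : ℤ) : ℝ))]
      simp_rw [sum_signPair_left, sign_mul_eq_one_iff]
      split_ifs with h
      · simp [h]
      · push Not at h
        obtain ⟨a, ha⟩ := h
        exact Finset.prod_eq_zero (Finset.mem_univ a) (if_neg ha)
    simp_rw [this]
    rw [← Finset.sum_filter, Finset.sum_const, nsmul_eq_mul, card_constant_spins]
    · norm_num
    · exact fun σ => ⟨hU σ, fun h a => h _ _⟩
  rw [Finset.sum_comm, h2] at h1
  exact_mod_cast h1.symm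

/-- If all cuts are even subgraphs and Euler's formula holds, then every even subgraph is a cut,
in two ways. -/
theorem sum_even_subgraphs [DecidableEq A] [Nonempty U] [Nonempty W] (i k : A → U) (p q : A → W)
    (hU : ∀ σ : U → ℤˣ, (∀ a, σ (i a) = σ (k a)) → ∀ x y, σ x = σ y)
    (hW : ∀ s : W → ℤˣ, (∀ a, s (p a) = s (q a)) → ∀ x y, s x = s y)
    (hcut : ∀ s : W → ℤˣ, spinBoundary i k (spinCut p q s) = 1)
    (euler : Fintype.card U + Fintype.card W = Fintype.card A + 2) (f : (A → ℤˣ) → ℝ) :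
    2 * ∑ ε with spinBoundary i k ε = 1, f ε = ∑ s : W → ℤˣ, f (spinCut p q s) := by
  -- Taking cuts is a homomorphism whose kernel consists of the two constants, so multiplication by
  -- `s₀` matches its fibre with the kernel.
  have hfib : ∀ s₀ : W → ℤˣ,
      (Finset.univ.filter fun s => spinCut p q s = spinCut p q s₀).card = 2 := by
    intro s₀
    have : (Finset.univ.filter fun s => spinCut p q s = spinCut p q s₀).card =
        (Finset.univ.filter fun s : W → ℤˣ => ∀ x y, s x = s y).card := by
      refine Finset.card_bij' (fun s _ => s * s₀) (fun s _ => s * s₀) ?_ ?_ ?_ ?_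
      · intro s hs
        simp only [Finset.mem_filter, Finset.mem_univ, true_and] at hs ⊢
        refine hW _ fun a => ?_
        have := congrFun hs a
        simp only [spinCut, Pi.mul_apply] at this ⊢
        revert this
        generalize s (p a) = x1, s (q a) = x2, s₀ (p a) = x3, s₀ (q a) = x4
        revert x1 x2 x3 x4
        decide
      · intro s hs
        simp only [Finset.mem_filter, Finset.mem_univ, true_and] at hs ⊢
        ext a
        have := hs (p a) (q a)
        simp only [spinCut, Pi.mul_apply, this]
        congr 1
        revert this
        generalize s (p a) = x1, s (q a) = x2, s₀ (p a) = x3, s₀ (q a) = x4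
        revert x1 x2 x3 x4
        decide
      · intro s _
        ext w
        simp [mul_assoc]
      · intro s _
        ext w
        simp [mul_assoc]
    rw [this, card_constant_spins]
    exact fun s => Iff.rfl
  have himg : Finset.univ.image (spinCut p q) =
      Finset.univ.filter fun ε => spinBoundary i k ε = 1 := by
    refine Finset.eq_of_subset_of_card_le ?_ ?_
    · intro ε hε
      obtain ⟨s, -, rfl⟩ := Finset.mem_image.1 hε
      simpa using hcut s
    -- There are `2 ^ (|A| - |U| + 1)` even subgraphs and `2 ^ (|W| - 1)` cuts; Euler's formula
    -- makes these numbers equal. The comparison is made after multiplication by powers of `2`.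
    · have h1 := card_even_subgraphs i k hU
      have h2 : 2 ^ Fintype.card W = (Finset.univ.image (spinCut p q)).card * 2 := by
        have := Finset.card_eq_sum_card_image (spinCut p q) (Finset.univ : Finset (W → ℤˣ))
        rw [Finset.sum_congr rfl (g := fun _ => 2), Finset.sum_const] at this
        · rw [← smul_eq_mul, ← this, Finset.card_univ, Fintype.card_fun]
          rfl
        · intro ε hε
          obtain ⟨s, -, rfl⟩ := Finset.mem_image.1 hε
          exact hfib s
      have h3 : (2 : ℕ) ^ Fintype.card U * 2 ^ Fintype.card W = 2 ^ Fintype.card A * 4 := by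
        rw [← pow_add, euler, pow_add]
        norm_num
      have h4 : 0 < 2 ^ Fintype.card U := by positivity
      nlinarith
  rw [← himg, Finset.sum_comp f (spinCut p q) (s := Finset.univ), Finset.mul_sum]
  refine Finset.sum_congr rfl fun ε hε => ?_
  obtain ⟨s, -, rfl⟩ := Finset.mem_image.1 hε
  rw [hfib]
  simp

end Spins

/-- The Boltzmann weight of an edge in the infinite-coupling limit of the Ashkin--Teller model, at
which the products of the two kinds of spins are `a` and `b`. -/
def iclatWeight {R : Type*} [Zero R] [One R] (x y : R) (a b : ℤˣ) : R :=
  if a = 1 then if b = 1 then 1 else y else if b = 1 then x else 0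

/-! ### Edge weights and the duality identity -/

section Spins

variable {U W A : Type*} [Fintype U] [Fintype W] [Fintype A]
  [DecidableEq U] [DecidableEq W]

/-- The high-temperature expansion of an edge between two three-spin interactions. -/
noncomputable def edgeWeight (J : ℝ) (ε t t' : ℤˣ) : ℝ :=
  if ε = 1 then if t = t' then Real.cosh (2 * J) else 1
  else if t = t' then (t : ℤ) * Real.sinh (2 * J) else 0

/-- The exponent is `2Jxt` for `t = t'` and `0` otherwise. Since `xt` is a sign, the exponential is
`cosh 2J + x t sinh 2J` in the first case and `1` in the second. -/
theorem exp_eq_sum_edgeWeight (J : ℝ) (x t t' : ℤˣ) :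
    Real.exp (J * ((x : ℤ) * ((t : ℤ) + (t' : ℤ)))) =
      ∑ ε, ((signPair ε x : ℤ) : ℝ) * edgeWeight J ε t t' := by
  rw [sum_signs]
  have h : Real.exp (J * 2) = Real.cosh (2 * J) + Real.sinh (2 * J) := by
    rw [Real.cosh_add_sinh, mul_comm]
  have h' : Real.exp (-(J * 2)) = Real.cosh (2 * J) - Real.sinh (2 * J) := by
    rw [Real.cosh_sub_sinh, mul_comm]
  rcases Int.units_eq_one_or x with rfl | rfl <;> rcases Int.units_eq_one_or t with rfl | rfl <;>
    rcases Int.units_eq_one_or t' with rfl | rfl <;>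
    norm_num [signPair, edgeWeight, h, h', sub_eq_add_neg]

/-- The only part of the weight that depends on more than the products of spins is the sign `t` of a
wall. It is split off here so that the signs of all walls can be treated together. -/
theorem edgeWeight_eq (J : ℝ) (ε t t' : ℤˣ) (h : ε = 1 ∨ t = t') :
    edgeWeight J ε t t' = ((signPair ε t : ℤ) : ℝ) * (Real.cosh (2 * J) *
      iclatWeight (1 / Real.cosh (2 * J)) (Real.tanh (2 * J)) (t * t') ε) := by
  have hc : Real.cosh (2 * J) ≠ 0 := (Real.cosh_pos _).ne'
  have ht : Real.cosh (2 * J) * Real.tanh (2 * J) = Real.sinh (2 * J) := by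
    rw [Real.tanh_eq_sinh_div_cosh, mul_div_cancel₀ _ hc]
  have h1 : (-1 : ℤˣ) ≠ 1 := by decide
  rcases Int.units_eq_one_or ε with rfl | rfl <;> rcases Int.units_eq_one_or t with rfl | rfl <;>
    rcases Int.units_eq_one_or t' with rfl | rfl <;>
    simp_all [signPair, edgeWeight, iclatWeight]

/-- Duality between a pair of coupled Ising models on a plane graph, with edges `A` that join the
vertices `i a`, `k a` and separate the faces `p a`, `q a`, and the infinite-coupling limit of the
Ashkin--Teller model on its dual. -/
theorem sum_exp_eq_sum_iclatWeight [Nonempty U] [Nonempty W] (i k : A → U) (p q : A → W)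
    (hU : ∀ σ : U → ℤˣ, (∀ a, σ (i a) = σ (k a)) → ∀ x y, σ x = σ y)
    (hW : ∀ s : W → ℤˣ, (∀ a, s (p a) = s (q a)) → ∀ x y, s x = s y)
    (hcut : ∀ s : W → ℤˣ, spinBoundary i k (spinCut p q s) = 1)
    (euler : Fintype.card U + Fintype.card W = Fintype.card A + 2)
    (hsign : ∀ s τ : W → ℤˣ, (∀ a, s (p a) * s (q a) = 1 ∨ τ (p a) = τ (q a)) →
      ∏ a, signPair (s (p a) * s (q a)) (τ (p a)) = 1) (J : ℝ) :
    2 * ∑ σ : U → ℤˣ, ∑ τ : W → ℤˣ, Real.exp (J * ∑ a, (((σ (i a) * σ (k a) : ℤˣ) : ℤ) : ℝ) *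
        (((τ (p a) : ℤ) : ℝ) + ((τ (q a) : ℤ) : ℝ))) =
      2 ^ Fintype.card U * Real.cosh (2 * J) ^ Fintype.card A *
        ∑ τ : W → ℤˣ, ∑ s : W → ℤˣ, ∏ a, iclatWeight (1 / Real.cosh (2 * J)) (Real.tanh (2 * J))
          (τ (p a) * τ (q a)) (s (p a) * s (q a)) := by
  classical
  rw [Finset.sum_comm, Finset.mul_sum, Finset.mul_sum]
  refine Finset.sum_congr rfl fun τ _ => ?_
  have h1 : ∑ σ : U → ℤˣ, Real.exp (J * ∑ a, (((σ (i a) * σ (k a) : ℤˣ) : ℤ) : ℝ) *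
        (((τ (p a) : ℤ) : ℝ) + ((τ (q a) : ℤ) : ℝ))) =
      ∑ ε : A → ℤˣ, (∏ a, edgeWeight J (ε a) (τ (p a)) (τ (q a))) *
        ∑ σ : U → ℤˣ, ∏ a, ((signPair (ε a) (σ (i a) * σ (k a)) : ℤ) : ℝ) := by
    simp_rw [Finset.mul_sum]
    rw [Finset.sum_comm]
    refine Finset.sum_congr rfl fun σ _ => ?_
    rw [Real.exp_sum]
    simp_rw [exp_eq_sum_edgeWeight]
    rw [Fintype.prod_sum]
    refine Finset.sum_congr rfl fun ε _ => ?_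
    rw [Finset.prod_mul_distrib, mul_comm]
  have h2 : ∀ s : W → ℤˣ, ∏ a, edgeWeight J (spinCut p q s a) (τ (p a)) (τ (q a)) =
      Real.cosh (2 * J) ^ Fintype.card A *
        ∏ a, iclatWeight (1 / Real.cosh (2 * J)) (Real.tanh (2 * J))
          (τ (p a) * τ (q a)) (s (p a) * s (q a)) := by
    intro s
    -- If no edge is a wall of both `s` and `τ`, the signs cancel by `hsign`. Otherwise such an edge
    -- has weight `0` on both sides.
    by_cases h : ∀ a, s (p a) * s (q a) = 1 ∨ τ (p a) = τ (q a)
    · have hs := congrArg (fun x : ℤˣ => ((x : ℤ) : ℝ)) (hsign s τ h)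
      simp only [Units.coe_prod, Int.cast_prod, Units.val_one, Int.cast_one] at hs
      rw [Finset.prod_congr rfl fun a _ => edgeWeight_eq J (spinCut p q s a) _ _ (h a)]
      simp only [spinCut]
      rw [Finset.prod_mul_distrib, hs, one_mul, Finset.prod_mul_distrib, Finset.prod_const,
        Finset.card_univ]
    · push Not at h
      obtain ⟨a, ha1, ha2⟩ := h
      rw [Finset.prod_eq_zero (Finset.mem_univ a), Finset.prod_eq_zero (Finset.mem_univ a),
        mul_zero]
      · rw [iclatWeight, if_neg ((sign_mul_eq_one_iff _ _).not.2 ha2), if_neg ha1]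
      · rw [edgeWeight, spinCut, if_neg ha1, if_neg ha2]
  rw [h1]
  simp_rw [sum_prod_signPair_spins, mul_ite, mul_zero]
  -- The factor `2` on the left absorbs the two spin configurations that belong to each even
  -- subgraph.
  rw [← Finset.sum_filter, ← Finset.sum_mul, ← mul_assoc,
    sum_even_subgraphs i k p q hU hW hcut euler
      (fun ε => ∏ a, edgeWeight J (ε a) (τ (p a)) (τ (q a)))]
  simp_rw [h2]
  rw [← Finset.mul_sum]
  ring

end Spins

/-! ### The Ashkin--Teller limit as a polynomial in the edge weights -/

namespace Multigraph

variable (G : Multigraph)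

/-- The product of the two Ising spins at the ends of an edge, as a sign. -/
def bondSign (s : G.V → ℤˣ) (e : G.E) : ℤˣ := ((G.ends e).map s).mul

theorem bondSign_of_ends {s : G.V → ℤˣ} {e : G.E} {v w : G.V} (h : G.ends e = s(v, w)) :
    G.bondSign s e = s v * s w := by
  rw [bondSign, h]
  rfl

variable [Fintype G.V] [Fintype G.E]

open Classical in
/-- The partition function of the infinite-coupling-limit Ashkin--Teller model as a polynomial in
the edge weights. -/
noncomputable def polyICLAT (x y : ℂ) : ℂ :=
  ∑ s : G.V → ℤˣ, ∑ t : G.V → ℤˣ, ∏ e, iclatWeight x y (G.bondSign s e) (G.bondSign t e)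

/-- With the chosen zero of energy, `L` cancels unless `a = b = -1`. In that case the exponent is
`4L - 2L₂ - 2L₂'`, whose real part tends to `-∞`. -/
theorem tendsto_edge_iclatWeight (L₂ L₂' : ℂ) (a b : ℤˣ) :
    Filter.Tendsto (fun L : ℝ => Complex.exp ((L - L₂ - L₂') + (L₂ - L) * (a : ℤ)
      + (L₂' - L) * (b : ℤ) + L * ((a : ℤ) * (b : ℤ)))) Filter.atBot
      (nhds (iclatWeight (Complex.exp (-2 * L₂)) (Complex.exp (-2 * L₂')) a b)) := by
  rcases Int.units_eq_one_or a with rfl | rfl <;> rcases Int.units_eq_one_or b with rfl | rfl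
  · refine tendsto_const_nhds.congr fun L => ?_
    simp only [iclatWeight, if_true]
    rw [← Complex.exp_zero]
    congr 1
    push_cast
    ring
  · refine tendsto_const_nhds.congr fun L => ?_
    have : (-1 : ℤˣ) ≠ 1 := by decide
    simp only [iclatWeight, if_neg this, if_true]
    congr 1
    push_cast
    ring
  · refine tendsto_const_nhds.congr fun L => ?_
    have : (-1 : ℤˣ) ≠ 1 := by decide
    simp only [iclatWeight, if_neg this, if_true]
    congr 1
    push_cast
    ring
  · have : (-1 : ℤˣ) ≠ 1 := by decide
    simp only [iclatWeight, if_neg this]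
    refine Complex.tendsto_exp_comap_re_atBot.comp (Filter.tendsto_comap_iff.2 ?_)
    have : (Complex.re ∘ fun L : ℝ => ((L : ℂ) - L₂ - L₂') + (L₂ - L) * ((-1 : ℤˣ) : ℤ)
      + (L₂' - L) * ((-1 : ℤˣ) : ℤ) + L * (((-1 : ℤˣ) : ℤ) * ((-1 : ℤˣ) : ℤ))) =
        fun L : ℝ => 4 * L + (-2 * L₂.re - 2 * L₂'.re) := by
      funext L
      simp
      ring
    rw [this]
    exact Filter.tendsto_atBot_add_const_right _ _
      (Filter.tendsto_id.const_mul_atBot (by norm_num))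

theorem tendsto_preZICLAT (L₂ L₂' : ℂ) :
    Filter.Tendsto (G.preZICLAT L₂ L₂') Filter.atBot
      (nhds (G.polyICLAT (Complex.exp (-2 * L₂)) (Complex.exp (-2 * L₂')))) := by
  refine tendsto_finsetSum _ fun s _ => tendsto_finsetSum _ fun t _ => ?_
  simp only [hamICLAT, neg_neg, Complex.exp_sum]
  exact tendsto_finsetProd _ fun e _ =>
    tendsto_edge_iclatWeight L₂ L₂' (G.bondSign s e) (G.bondSign t e)

theorem ZICLAT_eq (L₂ L₂' : ℂ) :
    G.ZICLAT L₂ L₂' = G.polyICLAT (Complex.exp (-2 * L₂)) (Complex.exp (-2 * L₂')) :=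
  (G.tendsto_preZICLAT L₂ L₂').limUnder_eq

/-- This serves the case `J = 0`, where the second weight is `0` and is not the exponential of any
finite coupling. -/
theorem continuous_polyICLAT (x : ℂ) : Continuous (G.polyICLAT x) := by
  refine continuous_finsetSum _ fun s _ => continuous_finsetSum _ fun t _ =>
    continuous_finsetProd _ fun e _ => ?_
  unfold iclatWeight
  split_ifs <;> fun_prop

/-- Parallel edges see the same spins, so each weight is squared; the weights `0` and `1` are
unchanged by this. -/
theorem doubled_polyICLAT (x y : ℂ) :
    G.doubled.polyICLAT x y = G.polyICLAT (x ^ 2) (y ^ 2) := by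
  refine Finset.sum_congr rfl fun s _ => Finset.sum_congr rfl fun t _ => ?_
  refine (Fintype.prod_prod_type _).trans (Finset.prod_congr rfl fun e _ => ?_)
  rw [Fintype.prod_bool]
  change iclatWeight x y (G.bondSign s e) (G.bondSign t e) *
    iclatWeight x y (G.bondSign s e) (G.bondSign t e) = _
  unfold iclatWeight
  split_ifs <;> ring

theorem doubled_ZICLAT (L₂ L₂' : ℂ) :
    G.doubled.ZICLAT L₂ L₂' = G.ZICLAT (2 * L₂) (2 * L₂') := by
  rw [ZICLAT_eq, ZICLAT_eq, doubled_polyICLAT, ← Complex.exp_nat_mul, ← Complex.exp_nat_mul]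
  congr 2 <;> push_cast <;> ring

/-- The partition function in terms of labels of vertices and edges. -/
theorem polyICLAT_reindex {W A : Type*} [Fintype W] [Fintype A] [DecidableEq W]
    (β : W ≃ G.V) (ε : A ≃ G.E) (p q : A → W) (h : ∀ a, G.ends (ε a) = s(β (p a), β (q a)))
    (x y : ℂ) :
    G.polyICLAT x y = ∑ s : W → ℤˣ, ∑ t : W → ℤˣ,
      ∏ a, iclatWeight x y (s (p a) * s (q a)) (t (p a) * t (q a)) := by
  classical
  have hb : ∀ (s : G.V → ℤˣ) a, G.bondSign s (ε a) = s (β (p a)) * s (β (q a)) :=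
    fun s a => G.bondSign_of_ends (h a)
  unfold polyICLAT
  refine Fintype.sum_equiv (β.symm.arrowCongr (Equiv.refl _)) _ _ fun s => ?_
  refine Fintype.sum_equiv (β.symm.arrowCongr (Equiv.refl _)) _ _ fun t => ?_
  refine (Fintype.prod_equiv ε _ _ fun a => ?_).symm
  rw [hb, hb]
  rfl

end Multigraph

/-! ### The couplings -/

theorem inv_cosh_sq_add_tanh_sq (x : ℝ) : (1 / Real.cosh x) ^ 2 + Real.tanh x ^ 2 = 1 := by
  have hc : Real.cosh x ≠ 0 := (Real.cosh_pos _).ne'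
  rw [Real.tanh_eq_sinh_div_cosh]
  field_simp
  rw [Real.cosh_sq]
  ring

theorem exists_exp_neg_two_mul {z : ℂ} (hz : z ≠ 0) : ∃ L : ℂ, Complex.exp (-2 * L) = z :=
  ⟨-Complex.log z / 2, by
    rw [show -2 * (-Complex.log z / 2) = Complex.log z by ring, Complex.exp_log hz]⟩

theorem exp_neg_two_mul_iff {x : ℝ} (hx : 0 < x) (L : ℝ) :
    Real.exp (-2 * L) = x ↔ L = -Real.log x / 2 := by
  constructor
  · rintro rfl
    rw [Real.log_exp]
    ring
  · rintro rfl
    rw [show -2 * (-Real.log x / 2) = Real.log x by ring, Real.exp_log hx]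

theorem tanh_ne_zero {x : ℝ} (hx : x ≠ 0) : Real.tanh x ≠ 0 := by
  rw [Real.tanh_eq_sinh_div_cosh]
  exact div_ne_zero (Real.sinh_ne_zero.2 hx) (Real.cosh_pos _).ne'

theorem tanh_pos_of_pos {x : ℝ} (hx : 0 < x) : 0 < Real.tanh x := by
  rw [Real.tanh_eq_sinh_div_cosh]
  exact div_pos (Real.sinh_pos_iff.2 hx) (Real.cosh_pos _)

theorem exists_complex_couplings {J : ℝ} (hJ : J ≠ 0) : ∃ L₂ L₂' : ℂ,
    Complex.exp (-2 * L₂) = ((1 / Real.cosh (2 * J) : ℝ) : ℂ) ∧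
    Complex.exp (-2 * L₂') = (Real.tanh (2 * J) : ℂ) := by
  obtain ⟨L, hL⟩ := exists_exp_neg_two_mul (z := ((1 / Real.cosh (2 * J) : ℝ) : ℂ))
    (Complex.ofReal_ne_zero.2 (one_div_pos.2 (Real.cosh_pos _)).ne')
  obtain ⟨L', hL'⟩ := exists_exp_neg_two_mul (z := (Real.tanh (2 * J) : ℂ))
    (Complex.ofReal_ne_zero.2 (tanh_ne_zero (mul_ne_zero two_ne_zero hJ)))
  exact ⟨L, L', hL, hL'⟩

theorem existsUnique_real_couplings {J : ℝ} (hJ : 0 < J) : ∃! L : ℝ × ℝ,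
    Real.exp (-2 * L.1) = 1 / Real.cosh (2 * J) ∧ Real.exp (-2 * L.2) = Real.tanh (2 * J) := by
  simp_rw [exp_neg_two_mul_iff (one_div_pos.2 (Real.cosh_pos (2 * J))),
    exp_neg_two_mul_iff (tanh_pos_of_pos (mul_pos two_pos hJ))]
  exact ⟨(_, _), ⟨rfl, rfl⟩, fun L h => Prod.ext h.1 h.2⟩

theorem couplings_circle {J : ℝ} {L₂ L₂' : ℂ}
    (h : Complex.exp (-2 * L₂) = ((1 / Real.cosh (2 * J) : ℝ) : ℂ))
    (h' : Complex.exp (-2 * L₂') = (Real.tanh (2 * J) : ℂ)) :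
    Complex.exp (-2 * L₂) ^ 2 + Complex.exp (-2 * L₂') ^ 2 = 1 := by
  rw [h, h']
  exact_mod_cast inv_cosh_sq_add_tanh_sq (2 * J)

theorem couplings_line {L₂ L₂' : ℂ}
    (h : Complex.exp (-2 * L₂) ^ 2 + Complex.exp (-2 * L₂') ^ 2 = 1) :
    Complex.exp (-2 * (2 * L₂)) + Complex.exp (-2 * (2 * L₂')) = 1 := by
  rw [← h, ← Complex.exp_nat_mul, ← Complex.exp_nat_mul]
  congr 2 <;> push_cast <;> ring

/-- A product over a finite orbit. -/
theorem Equiv.Perm.prod_sameCycle {α X : Type*} [Fintype α] [CommMonoid X] (σ : Equiv.Perm α)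
    (a : α) (P : α → Prop) [DecidablePred P] (hP : ∀ b, P b ↔ σ.SameCycle a b) (f : α → X) :
    ∏ b with P b, f b = ∏ i ∈ Finset.range (Function.minimalPeriod σ a), f (σ^[i] a) := by
  classical
  have ha : 0 < Function.minimalPeriod σ a :=
    Function.minimalPeriod_pos_of_mem_periodicPts
      (Function.Injective.mem_periodicPts σ.injective a)
  rw [Finset.prod_range]
  simp_rw [Finset.filter_congr fun b _ => hP b]
  rw [Finset.prod_subtype (p := σ.SameCycle a) _ (by simp)]
  exact (Fintype.prod_bijective _ (σ.bijective_iterate_sameCycle ha) _ _ fun i => rfl).symm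

/-! ### Plane triangulations: connectedness, counting, energy and signs -/

namespace CombMap

variable {D : Type*} {M : CombMap D}

/-- Any two darts are related by an element of the group generated by `rot` and `rev`, and
invariance passes from the generators to the group. -/
theorem IsPlane.eq_of_invariant (hM : M.IsPlane) {X : Type*} {f : D → X}
    (hrot : ∀ d, f (M.rot d) = f d) (hrev : ∀ d, f (M.rev d) = f d) (a b : D) : f a = f b := by
  have h := hM.connected
  obtain ⟨⟨g, hg⟩, rfl⟩ := h.exists_smul_eq a b
  change f a = f (g a)
  induction hg using Subgroup.closure_induction generalizing a with
  | mem g hg =>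
    rcases hg with rfl | rfl
    · exact (hrot a).symm
    · exact (hrev a).symm
  | one => rfl
  | mul g h _ _ ihg ihh => rw [Equiv.Perm.mul_apply, ← ihg, ← ihh]
  | inv g _ ih =>
    have := ih (g⁻¹ a)
    rw [this]
    exact congrArg f (g.apply_symm_apply a).symm

/-- Without darts there are no vertices, edges or faces, and Euler's formula would read `0 = 2`. -/
theorem IsPlane.nonempty [Finite D] (hM : M.IsPlane) : Nonempty D := by
  by_contra h
  rw [not_nonempty_iff] at h
  have h1 : IsEmpty M.Vertex := M.vert_surjective.isEmpty
  have h2 : IsEmpty M.Edge := M.edge_surjective.isEmpty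
  have h3 : IsEmpty M.Face := M.face_surjective.isEmpty
  have := hM.euler
  simp at this

variable {c : M.Vertex → Fin 3}

theorem IsTriangulation.minimalPeriod_facePerm (hT : M.IsTriangulation) (d : D) :
    Function.minimalPeriod M.facePerm d = 3 :=
  Function.minimalPeriod_eq_prime (p := 3) (hT.triangle d).2 (hT.triangle d).1

theorem IsTriangulation.eq_of_face_eq (hT : M.IsTriangulation) {a b : D}
    (h : M.face a = M.face b) : b = a ∨ b = M.facePerm a ∨ b = M.facePerm (M.facePerm a) := by
  have h3 := hT.minimalPeriod_facePerm a
  obtain ⟨⟨i, hi⟩, h⟩ := (M.facePerm.bijective_iterate_sameCycle (a := a) (by omega)).2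
    ⟨b, M.face_eq_iff.1 h⟩
  have h := Subtype.ext_iff.1 h
  dsimp only at h
  rw [h3] at hi
  interval_cases i
  · exact Or.inl h.symm
  · exact Or.inr (Or.inl h.symm)
  · exact Or.inr (Or.inr h.symm)

/-- The corners of a triangle have three different colours, so its sides have three different pairs
of colours. -/
theorem IsProper.eq_of_mem_of_face_eq (hc : M.IsProper c) (hT : M.IsTriangulation) {a b : D}
    (ha : M.edge a ∈ M.edgesBetween c 0 2) (hb : M.edge b ∈ M.edgesBetween c 0 2)
    (h : M.face a = M.face b) : a = b := by
  obtain ⟨h1, h2, h3⟩ := hc.face_colours hT a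
  rw [mem_edgesBetween] at ha hb
  rcases hT.eq_of_face_eq h with rfl | rfl | rfl
  · rfl
  · rw [vert_facePerm] at hb
    omega
  · rw [vert_facePerm] at hb
    omega

/-- The two ends of consecutive darts at a vertex have different colours. -/
theorem IsProper.star_colours (hc : M.IsProper c) (hT : M.IsTriangulation) (d : D) :
    c (M.vert (M.rev d)) ≠ c (M.vert d) ∧
      c (M.vert d) ≠ c (M.vert (M.rev (M.rot d))) ∧
      c (M.vert (M.rev (M.rot d))) ≠ c (M.vert (M.rev d)) := by
  have h := hc.face_colours hT (M.rev d)
  simpa only [facePerm_apply, M.rev_rev] using h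

variable (M c) in
/-- The two faces on the sides of the edges between the colours `0` and `2`. -/
def crossFace (a : M.CrossDart c × Bool) : M.Face :=
  M.face (if a.2 then M.rev a.1 else a.1)

/-- Each triangle is determined by its unique side in `E₁₃`, opposite to the corner of colour `1`,
together with the side of this edge on which it lies. This gives both `|F| = 2|E₁₃|` and the
regrouping of the energy. -/
theorem IsProper.crossFace_bijective (hc : M.IsProper c) (hT : M.IsTriangulation) :
    Function.Bijective (M.crossFace c) := by
  constructor
  · rintro ⟨⟨a, ha⟩, x⟩ ⟨⟨b, hb⟩, y⟩ h
    have ha' := M.mem_edgesBetween.2 (Or.inr ha)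
    have hb' := M.mem_edgesBetween.2 (Or.inr hb)
    have key := hc.eq_of_mem_of_face_eq hT (a := if x then M.rev a else a)
      (b := if y then M.rev b else b) (by split_ifs <;> simpa) (by split_ifs <;> simpa) h
    cases x <;> cases y
    · simp only [Bool.false_eq_true, if_false] at key
      subst key
      rfl
    · simp only [Bool.false_eq_true, if_false, if_true] at key
      subst key
      have := hb.2.symm.trans ha.1
      exact absurd this (by decide)
    · simp only [Bool.false_eq_true, if_false, if_true] at key
      subst key
      have := ha.2.symm.trans hb.1
      exact absurd this (by decide)
    · simp only [if_true] at key
      obtain rfl := M.rev.injective key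
      rfl
  · have hd : ∀ d, M.edge d ∈ M.edgesBetween c 0 2 → ∃ a, M.crossFace c a = M.face d := by
      intro d h
      rcases M.mem_edgesBetween.1 h with h | h
      · exact ⟨(⟨M.rev d, h.2, by rw [M.rev_rev]; exact h.1⟩, true),
          congrArg M.face (M.rev_rev d)⟩
      · exact ⟨(⟨d, h⟩, false), rfl⟩
    intro f
    obtain ⟨d, rfl⟩ := M.face_surjective f
    obtain ⟨h1, h2, h3⟩ := hc.face_colours hT d
    by_cases e1 : c (M.vert d) = 1
    · obtain ⟨a, ha⟩ := hd (M.facePerm d) (by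
        rw [mem_edgesBetween, vert_facePerm]
        omega)
      exact ⟨a, ha.trans (M.face_facePerm d)⟩
    by_cases e2 : c (M.vert (M.rev d)) = 1
    · obtain ⟨a, ha⟩ := hd (M.facePerm (M.facePerm d)) (by
        rw [mem_edgesBetween, vert_facePerm, hT.facePerm_facePerm, M.rev_rev, vert_rot_symm]
        omega)
      exact ⟨a, ha.trans (by rw [face_facePerm, face_facePerm])⟩
    · exact hd d (by
        rw [mem_edgesBetween]
        omega)

/-- Spins that agree at the ends of all edges between the colours `0` and `2` are constant on
these colours. -/
theorem IsPlane.eq_of_cross (hM : M.IsPlane) (hT : M.IsTriangulation) (hc : M.IsProper c)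
    {X : Type*} {f : M.Vertex → X}
    (hf : ∀ d, M.edge d ∈ M.edgesBetween c 0 2 → f (M.vert d) = f (M.vert (M.rev d)))
    {v w : M.Vertex} (hv : c v ≠ 1) (hw : c w ≠ 1) : f v = f w := by
  obtain ⟨a, rfl⟩ := M.vert_surjective v
  obtain ⟨b, rfl⟩ := M.vert_surjective w
  -- At a dart that leaves a vertex of colour `1`, the value at its far end is used. A rotation
  -- there moves the far end along the third side of a triangle, which lies in `E₁₃`.
  have key := hM.eq_of_invariant
    (f := fun d => if c (M.vert d) = 1 then f (M.vert (M.rev d)) else f (M.vert d)) (by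
      intro d
      rw [vert_rot]
      split_ifs with hd
      · obtain ⟨h1, h2, h3⟩ := hc.star_colours hT d
        have e : M.vert (M.rev (M.facePerm (M.rot d))) = M.vert (M.rev d) := by
          have := hT.facePerm_facePerm (M.rev d)
          rw [facePerm_apply M (M.rev d), M.rev_rev] at this
          rw [this, M.rev_rev, vert_rot_symm]
        have := hf (M.facePerm (M.rot d)) (by
          rw [mem_edgesBetween, vert_facePerm, e]
          omega)
        rwa [vert_facePerm, e] at this
      · rfl) (by
      intro d
      have hd := hc d
      rw [M.rev_rev]
      split_ifs with h1 h2 h2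
      · exact absurd (h2.trans h1.symm) hd
      · rfl
      · rfl
      · refine (hf d ?_).symm
        rw [mem_edgesBetween]
        omega) a b
  simpa only [if_neg hv, if_neg hw] using key

/-- The vertex of colour `1` of the face to the right of a dart. -/
def midVertex (hc : M.IsProper c) (hT : M.IsTriangulation) (d : D) : {v // c v = 1} :=
  ⟨M.mid c d, hc.colour_mid hT d⟩

theorem midVertex_rot (hc : M.IsProper c) (hT : M.IsTriangulation) (d : D) :
    midVertex hc hT (M.rot d) = midVertex hc hT (M.rev d) :=
  Subtype.ext (hc.mid_rot hT d)

theorem midVertex_rev (hc : M.IsProper c) (hT : M.IsTriangulation) {d : D}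
    (h : M.edge d ∉ M.edgesBetween c 0 2) :
    midVertex hc hT (M.rev d) = midVertex hc hT d :=
  Subtype.ext (hc.mid_rev h)

theorem midVertex_surjective (hc : M.IsProper c) (hT : M.IsTriangulation) :
    Function.Surjective (midVertex hc hT) := by
  rintro ⟨v, hv⟩
  obtain ⟨d, rfl⟩ := M.vert_surjective v
  exact ⟨d, Subtype.ext (mid_of_vert hv)⟩

/-- Spins of colour `1` that agree across all edges between the colours `0` and `2` are
constant. -/
theorem IsPlane.eq_of_midVertex (hM : M.IsPlane) (hT : M.IsTriangulation) (hc : M.IsProper c)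
    {X : Type*} {s : {v // c v = 1} → X}
    (hs : ∀ a : M.CrossDart c, s (midVertex hc hT a) = s (midVertex hc hT (M.rev a)))
    (v w : {v // c v = 1}) : s v = s w := by
  obtain ⟨a, rfl⟩ := midVertex_surjective hc hT v
  obtain ⟨b, rfl⟩ := midVertex_surjective hc hT w
  have hrev : ∀ d, s (midVertex hc hT (M.rev d)) = s (midVertex hc hT d) := by
    intro d
    by_cases h : M.edge d ∈ M.edgesBetween c 0 2
    · rcases M.mem_edgesBetween.1 h with h | h
      · have := hs ⟨M.rev d, h.2, by rw [M.rev_rev]; exact h.1⟩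
        simpa only [M.rev_rev] using this
      · exact (hs ⟨d, h⟩).symm
    · rw [midVertex_rev hc hT h]
  exact hM.eq_of_invariant (f := fun d => s (midVertex hc hT d))
    (fun d => by rw [midVertex_rot, hrev]) hrev a b

section Finite

variable [Fintype D]

theorem card_darts_eq_two_mul_card_edges : Fintype.card D = 2 * Fintype.card M.Edge := by
  classical
  have h := Finset.card_eq_sum_card_fiberwise (f := M.edge) (s := Finset.univ)
    (t := Finset.univ) (fun _ _ => Finset.mem_coe.2 (Finset.mem_univ _))
  rw [Finset.card_univ, Finset.sum_congr rfl (g := fun _ => 2), Finset.sum_const,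
    Finset.card_univ, smul_eq_mul] at h
  · omega
  · intro e _
    obtain ⟨d, rfl⟩ := M.edge_surjective e
    rw [show (Finset.univ.filter fun a => M.edge a = M.edge d) = {d, M.rev d} by
      ext a
      simp only [Finset.mem_filter, Finset.mem_univ, true_and, Finset.mem_insert,
        Finset.mem_singleton]
      rw [eq_comm, edge_eq_iff]]
    exact Finset.card_pair (M.rev_ne d).symm

theorem IsTriangulation.card_darts (hT : M.IsTriangulation) :
    Fintype.card D = 3 * Fintype.card M.Face := by
  classical
  have h := Finset.card_eq_sum_card_fiberwise (f := M.face) (s := Finset.univ)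
    (t := Finset.univ) (fun _ _ => Finset.mem_coe.2 (Finset.mem_univ _))
  rw [Finset.card_univ, Finset.sum_congr rfl (g := fun _ => 3), Finset.sum_const,
    Finset.card_univ, smul_eq_mul] at h
  · omega
  · intro f _
    obtain ⟨d, rfl⟩ := M.face_surjective f
    have hd := hT.minimalPeriod_facePerm d
    rw [← Fintype.card_subtype, ← Nat.card_eq_fintype_card]
    have h := Nat.card_congr (Equiv.ofBijective _
      (M.facePerm.bijective_iterate_sameCycle (a := d) (by omega)))
    rw [Nat.card_fin, hd] at h
    rw [h]
    exact Nat.card_congr (Equiv.subtypeEquivRight fun b => by rw [eq_comm, face_eq_iff])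

/-- From `2|E| = 3|F|` and `|F| = 2|E₁₃|` follows `|E| - |F| = |E₁₃|`. So Euler's formula for `G`
becomes the one for `G₁₃`, whose faces are counted by `V₂`. -/
theorem IsPlane.card_vertices (hM : M.IsPlane) (hT : M.IsTriangulation) (hc : M.IsProper c)
    [Fintype (M.CrossDart c)] : Fintype.card M.Vertex = Fintype.card (M.CrossDart c) + 2 := by
  have h1 := card_darts_eq_two_mul_card_edges (M := M)
  have h2 := hT.card_darts
  have h3 := Fintype.card_congr (Equiv.ofBijective _ (hc.crossFace_bijective hT))
  have h4 := hM.euler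
  simp only [Nat.card_eq_fintype_card] at h4
  rw [Fintype.card_prod, Fintype.card_bool] at h3
  omega

open Classical in
/-- The energy of the three-spin model as a sum over the edges between the colours `0` and `2`. -/
theorem sum_faces_eq_sum_cross (hT : M.IsTriangulation) (hc : M.IsProper c)
    (s : M.Vertex → ℤˣ) :
    ∑ f : M.Face, (((∏ d with M.face d = f, s (M.vert d) : ℤˣ) : ℤ) : ℝ) =
      ∑ a : M.CrossDart c, (((s (M.vert a) * s (M.vert (M.rev a)) : ℤˣ) : ℤ) : ℝ) *
        (((s (midVertex hc hT a) : ℤ) : ℝ) + ((s (midVertex hc hT (M.rev a)) : ℤ) : ℝ)) := by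
  have hface : ∀ d, ∏ d' with M.face d' = M.face d, s (M.vert d') =
      s (M.vert d) * s (M.vert (M.rev d)) * s (M.vert (M.rev (M.facePerm d))) := by
    intro d
    rw [M.facePerm.prod_sameCycle d _ (fun b => by rw [eq_comm, face_eq_iff]),
      hT.minimalPeriod_facePerm, Finset.prod_range_succ, Finset.prod_range_succ,
      Finset.prod_range_one]
    simp only [Function.iterate_succ_apply', Function.iterate_zero_apply, vert_facePerm]
  rw [← Equiv.sum_comp (Equiv.ofBijective _ (hc.crossFace_bijective hT)),
    Fintype.sum_prod_type]
  refine Finset.sum_congr rfl fun a _ => ?_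
  have ha := a.2
  have hm : ∀ d, M.edge d ∈ M.edgesBetween c 0 2 →
      M.vert (M.rev (M.facePerm d)) = midVertex hc hT d := by
    intro d hd
    rw [mem_edgesBetween] at hd
    change _ = M.mid c d
    rw [mid, if_neg (by omega), if_neg (by omega)]
  have hmem : M.edge a.1 ∈ M.edgesBetween c 0 2 := M.mem_edgesBetween.2 (Or.inr ha)
  rw [Fintype.sum_bool]
  simp only [Equiv.ofBijective_apply, crossFace, if_true, Bool.false_eq_true, if_false, hface]
  rw [hm _ hmem, hm _ (by rwa [edge_rev]), M.rev_rev]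
  push_cast
  ring

open Classical in
/-- The domain walls between the spins of colour `1` meet every vertex of the other colours an
even number of times. -/
theorem spinBoundary_spinCut (hT : M.IsTriangulation) (hc : M.IsProper c)
    (s : {v // c v = 1} → ℤˣ) (i k : M.CrossDart c → {v // ¬ c v = 1})
    (hi : ∀ a, (i a : M.Vertex) = M.vert a) (hk : ∀ a, (k a : M.Vertex) = M.vert (M.rev a)) :
    spinBoundary i k (spinCut (fun a => midVertex hc hT a)
      (fun a => midVertex hc hT (M.rev a)) s) = 1 := by
  funext ⟨u, hu⟩
  have hsub : ∀ f : D → ℤˣ, ∏ a : M.CrossDart c, f a =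
      ∏ d, if c (M.vert d) = 2 ∧ c (M.vert (M.rev d)) = 0 then f d else 1 := by
    intro f
    rw [← Finset.prod_filter]
    exact (Finset.prod_subtype _ (by simp) f).symm
  simp only [spinBoundary, spinCut, Subtype.ext_iff, hi, hk, Pi.one_apply]
  -- Reversing the darts of the second product makes both products run over darts that leave `u`.
  rw [hsub (fun d => if M.vert d = u then
      s (midVertex hc hT d) * s (midVertex hc hT (M.rev d)) else 1),
    hsub (fun d => if M.vert (M.rev d) = u then
      s (midVertex hc hT d) * s (midVertex hc hT (M.rev d)) else 1),
    ← Equiv.prod_comp M.rev (fun d => if c (M.vert d) = 2 ∧ c (M.vert (M.rev d)) = 0 then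
      (if M.vert (M.rev d) = u then _ else 1) else 1), ← Finset.prod_mul_distrib]
  have hsq : ∀ x : ℤˣ, x * x = 1 := by decide
  -- Edges outside `E₁₃` have the same vertex of colour `1` on both sides and contribute a square,
  -- so all darts at `u` may be included. As `mid (rev d) = mid (rot d)`, the factors telescope
  -- around `u`: the product is the square of `∏ s (mid d)`.
  trans ∏ d, ((if M.vert d = u then s (midVertex hc hT d) else 1) *
    if M.vert (M.rot d) = u then s (midVertex hc hT (M.rot d)) else 1)
  · refine Finset.prod_congr rfl fun d _ => ?_
    have h1 := hc d
    simp only [M.rev_rev, midVertex_rot, vert_rot]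
    by_cases hd : M.vert d = u
    · simp only [if_pos hd]
      by_cases hm : M.edge d ∈ M.edgesBetween c 0 2
      · rw [mem_edgesBetween] at hm
        rcases hm with hm | hm
        · rw [if_neg (by omega), if_pos ⟨hm.2, hm.1⟩, one_mul, mul_comm]
        · rw [if_pos hm, if_neg (by omega), mul_one]
      · rw [midVertex_rev hc hT hm, hsq]
        split_ifs <;> rfl
    · simp only [if_neg hd, ite_self, mul_one]
  · rw [Finset.prod_mul_distrib,
      Equiv.prod_comp M.rot (fun d => if M.vert d = u then s (midVertex hc hT d) else 1), hsq]

open Classical in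
/-- The sign of a set of domain walls is trivial when the vertices of colour `2` have degree `4`
or `6`. -/
theorem prod_signPair_eq_one (hT : M.IsTriangulation) (hc : M.IsProper c)
    (hdeg : ∀ v, c v = 2 → M.degree v = 4 ∨ M.degree v = 6) (s τ : {v // c v = 1} → ℤˣ)
    (h : ∀ a : M.CrossDart c, s (midVertex hc hT a) * s (midVertex hc hT (M.rev a)) = 1 ∨
      τ (midVertex hc hT a) = τ (midVertex hc hT (M.rev a))) :
    ∏ a : M.CrossDart c, signPair (s (midVertex hc hT a) * s (midVertex hc hT (M.rev a)))
      (τ (midVertex hc hT a)) = 1 := by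
  set f : D → ℤˣ := fun d => signPair (s (midVertex hc hT d) * s (midVertex hc hT (M.rev d)))
    (τ (midVertex hc hT d)) with hf
  set g : D → ℤˣ := fun d =>
    if c (M.vert d) = 2 ∧ c (M.vert (M.rev d)) = 0 then f d else 1 with hg
  have hsub : ∏ a : M.CrossDart c, f a = ∏ d, g d := by
    rw [hg, ← Finset.prod_filter]
    exact (Finset.prod_subtype _ (by simp) f).symm
  change ∏ a : M.CrossDart c, f a = 1
  rw [hsub, ← Finset.prod_fiberwise (s := Finset.univ) (g := M.vert)]
  refine Finset.prod_eq_one fun v _ => ?_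
  by_cases hv : c v = 2
  swap
  · refine Finset.prod_eq_one fun d hd => ?_
    rw [(Finset.mem_filter.1 hd).2.symm] at hv
    exact if_neg fun h => hv h.1
  have hex : ∃ d, M.vert d = v ∧ c (M.vert (M.rev d)) = 0 := by
    obtain ⟨d, rfl⟩ := M.vert_surjective v
    obtain ⟨h1, h2, h3⟩ := hc.star_colours hT d
    by_cases h0 : c (M.vert (M.rev d)) = 0
    · exact ⟨d, rfl, h0⟩
    · exact ⟨M.rot d, M.vert_rot d, by omega⟩
  obtain ⟨d, rfl, hd⟩ := hex
  -- The neighbours of a vertex of colour `2` alternate between the colours `0` and `1`. Two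
  -- rotations lead to the next edge of `E₁₃`, across a dart to colour `1` that contributes no sign.
  have hstep : ∀ d, c (M.vert d) = 2 → c (M.vert (M.rev d)) = 0 →
      c (M.vert (M.rev (M.rot (M.rot d)))) = 0 ∧ g (M.rot d) = 1 ∧
      midVertex hc hT (M.rot (M.rot d)) = midVertex hc hT (M.rot d) := by
    intro d hd2 hd0
    obtain ⟨h1, h2, h3⟩ := hc.star_colours hT d
    obtain ⟨h1', h2', h3'⟩ := hc.star_colours hT (M.rot d)
    rw [vert_rot] at h1' h2'
    refine ⟨by omega, if_neg (by omega), ?_⟩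
    rw [midVertex_rot]
    exact midVertex_rev hc hT (by rw [mem_edgesBetween, vert_rot]; omega)
  have hper : 0 < Function.minimalPeriod M.rot d :=
    Function.minimalPeriod_pos_of_mem_periodicPts
      (Function.Injective.mem_periodicPts M.rot.injective d)
  have hdegree := M.degree_vert d hper
  rw [M.rot.prod_sameCycle d _ (fun b => by rw [eq_comm, vert_eq_iff]), ← hdegree]
  have hgd : ∀ d, c (M.vert d) = 2 → c (M.vert (M.rev d)) = 0 → g d = f d :=
    fun d h2 h0 => if_pos ⟨h2, h0⟩
  have hloop : M.rot^[M.degree (M.vert d)] d = d := by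
    rw [hdegree, Function.iterate_minimalPeriod]
  obtain ⟨a0, a1, a2⟩ := hstep d hv hd
  have av : c (M.vert (M.rot (M.rot d))) = 2 := by rwa [vert_rot, vert_rot]
  obtain ⟨b0, b1, b2⟩ := hstep _ av a0
  have bv : c (M.vert (M.rot (M.rot (M.rot (M.rot d))))) = 2 := by rwa [vert_rot, vert_rot]
  have hA := h ⟨d, hv, hd⟩
  have hB := h ⟨_, av, a0⟩
  -- Closing the cycle identifies the last vertex of colour `1` with the first. Two or three pairs
  -- of spins remain, with `τ` equal across each wall of `s`, and the claim is a finite check.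
  rcases hdeg _ hv with h4 | h6
  · rw [h4] at hloop ⊢
    simp only [Finset.prod_range_succ, Finset.range_zero, Finset.prod_empty, one_mul,
      Function.iterate_succ_apply', Function.iterate_zero_apply] at hloop ⊢
    rw [a1, b1, hgd _ hv hd, hgd _ av a0]
    rw [hloop] at b2
    simp only [hf, ← midVertex_rot, a2, ← b2] at hA hB ⊢
    revert hA hB
    generalize s (midVertex hc hT d) = x0, s (midVertex hc hT (M.rot d)) = x1,
      τ (midVertex hc hT d) = y0, τ (midVertex hc hT (M.rot d)) = y1
    revert x0 x1 y0 y1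
    decide
  · obtain ⟨c0, c1, c2⟩ := hstep _ bv b0
    have hC := h ⟨_, bv, b0⟩
    rw [h6] at hloop ⊢
    simp only [Finset.prod_range_succ, Finset.range_zero, Finset.prod_empty, one_mul,
      Function.iterate_succ_apply', Function.iterate_zero_apply] at hloop ⊢
    rw [a1, b1, c1, hgd _ hv hd, hgd _ av a0, hgd _ bv b0]
    rw [hloop] at c2
    simp only [hf, ← midVertex_rot, a2, b2, ← c2] at hA hB hC ⊢
    revert hA hB hC
    generalize s (midVertex hc hT d) = x0, s (midVertex hc hT (M.rot d)) = x1,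
      s (midVertex hc hT (M.rot (M.rot (M.rot d)))) = x2,
      τ (midVertex hc hT d) = y0, τ (midVertex hc hT (M.rot d)) = y1,
      τ (midVertex hc hT (M.rot (M.rot (M.rot d)))) = y2
    revert x0 x1 x2 y0 y1 y2
    decide

/-- The Hintermann--Merlini--Baxter--Wu model as an infinite-coupling-limit Ashkin--Teller
model. -/
theorem ZHMBW_eq (hM : M.IsPlane) (hT : M.IsTriangulation) (hc : M.IsProper c)
    (hdeg : ∀ v, c v = 2 → M.degree v = 4 ∨ M.degree v = 6) (J : ℝ) :
    (M.ZHMBW J : ℂ) =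
      (2 : ℂ) ^ (-(Nat.card {v : M.Vertex // c v = 1} : ℤ) + 1)
        * ((2 * Real.cosh (2 * J) : ℝ) : ℂ) ^ Nat.card (M.edgesBetween c 0 2)
        * (M.dualSub (M.edgesBetween c 0 2)).polyICLAT ((1 / Real.cosh (2 * J) : ℝ) : ℂ)
          (Real.tanh (2 * J) : ℂ) := by
  classical
  obtain ⟨d₀⟩ := hM.nonempty
  have hW : Nonempty {v // c v = 1} := ⟨midVertex hc hT d₀⟩
  have hU : Nonempty {v // ¬ c v = 1} := by
    by_cases h : c (M.vert d₀) = 1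
    · exact ⟨⟨M.vert (M.rev d₀), fun h' => hc d₀ (h.trans h'.symm)⟩⟩
    · exact ⟨⟨_, h⟩⟩
  set i : M.CrossDart c → {v // ¬ c v = 1} := fun a => ⟨M.vert a, by rw [a.2.1]; decide⟩ with hi
  set k : M.CrossDart c → {v // ¬ c v = 1} :=
    fun a => ⟨M.vert (M.rev a), by rw [a.2.2]; decide⟩ with hk
  have euler : Fintype.card {v // ¬ c v = 1} + Fintype.card {v // c v = 1} =
      Fintype.card (M.CrossDart c) + 2 := by
    rw [← hM.card_vertices hT hc, add_comm]
    exact (Fintype.card_congr (Equiv.sumCompl fun v => c v = 1).symm).trans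
      Fintype.card_sum |>.symm
  have key := sum_exp_eq_sum_iclatWeight i k (fun a => midVertex hc hT a)
    (fun a => midVertex hc hT (M.rev a)) (by
      intro σ hσ x y
      -- The value at vertices of colour `1` is arbitrary, since edges of `E₁₃` do not meet them.
      have := hM.eq_of_cross hT hc (f := fun v => if h : ¬ c v = 1 then σ ⟨v, h⟩ else 1) (by
        intro d hd
        have hd' := M.mem_edgesBetween.1 hd
        rw [dif_pos (by omega), dif_pos (by omega)]
        rcases hd' with h | h
        · have := (hσ ⟨M.rev d, h.2, by rw [M.rev_rev]; exact h.1⟩).symm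
          simpa only [hi, hk, M.rev_rev] using this
        · exact hσ ⟨d, h⟩) x.2 y.2
      rw [dif_pos x.2, dif_pos y.2] at this
      exact this)
    (fun s hs => hM.eq_of_midVertex hT hc hs)
    (fun s => spinBoundary_spinCut hT hc s i k (fun _ => rfl) fun _ => rfl)
    euler (fun s τ => prod_signPair_eq_one hT hc hdeg s τ) J
  have hZ : M.ZHMBW J = ∑ σ : {v // ¬ c v = 1} → ℤˣ, ∑ τ : {v // c v = 1} → ℤˣ,
      Real.exp (J * ∑ a : M.CrossDart c, (((σ (i a) * σ (k a) : ℤˣ) : ℤ) : ℝ) *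
        (((τ (midVertex hc hT a) : ℤ) : ℝ) + ((τ (midVertex hc hT (M.rev a)) : ℤ) : ℝ))) := by
    rw [ZHMBW, Finset.sum_comm, ← Fintype.sum_prod_type']
    refine Fintype.sum_equiv (Equiv.piEquivPiSubtypeProd (fun v => c v = 1) fun _ => ℤˣ) _ _ ?_
    intro s
    rw [hamHMBW, sum_faces_eq_sum_cross hT hc s, neg_mul, neg_neg]
    rfl
  have hpoly := (M.dualSub (M.edgesBetween c 0 2)).polyICLAT_reindex (starFaceEquiv hc hT)
    (M.crossEquiv c) (fun a => midVertex hc hT a) (fun a => midVertex hc hT (M.rev a))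
    (dualSub_ends_crossEquiv hc hT) ((1 / Real.cosh (2 * J) : ℝ) : ℂ) (Real.tanh (2 * J) : ℂ)
  rw [← hZ] at key
  have key' := congrArg (fun x : ℝ => (x : ℂ)) key
  have hcast : ∀ a b, ((iclatWeight (1 / Real.cosh (2 * J)) (Real.tanh (2 * J)) a b : ℝ) : ℂ) =
      iclatWeight ((1 / Real.cosh (2 * J) : ℝ) : ℂ) (Real.tanh (2 * J) : ℂ) a b := by
    intro a b
    unfold iclatWeight
    split_ifs <;> norm_num
  rw [Complex.ofReal_mul, Complex.ofReal_mul, Complex.ofReal_sum] at key'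
  simp only [Complex.ofReal_sum, Complex.ofReal_prod, hcast] at key'
  rw [← hpoly] at key'
  have hE : Nat.card (M.edgesBetween c 0 2) = Fintype.card (M.CrossDart c) := by
    rw [← Nat.card_eq_fintype_card]
    exact Nat.card_congr (M.crossEquiv c).symm
  have h2 : (2 : ℂ) ≠ 0 := two_ne_zero
  rw [hE, Nat.card_eq_fintype_card]
  refine mul_left_cancel₀ h2 ?_
  rw [Complex.ofReal_ofNat] at key'
  rw [key', ← mul_assoc, ← mul_assoc]
  congr 1
  -- Euler's formula in the form `|V₁ ∪ V₃| = 1 + (1 - |V₂|) + |E₁₃|`; the leading `2` is the one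
  -- cancelled above.
  have hp : (2 : ℂ) ^ Fintype.card {v // ¬ c v = 1} =
      2 * (2 ^ (-(Fintype.card {v // c v = 1} : ℤ) + 1) * 2 ^ Fintype.card (M.CrossDart c)) := by
    rw [← zpow_natCast, ← zpow_natCast, ← zpow_add₀ h2, ← zpow_one_add₀ h2]
    congr 1
    omega
  rw [Complex.ofReal_mul, Complex.ofReal_pow, Complex.ofReal_pow, Complex.ofReal_ofNat, hp,
    Complex.ofReal_mul, Complex.ofReal_ofNat, mul_pow]
  ring

end Finite

end CombMap

/-! ### A criterion for the dual graphs of lattices -/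

namespace CombMap

variable {D : Type*}

theorem card_darts_face (M : CombMap D) (d : D) (hd : 0 < Function.minimalPeriod M.facePerm d) :
    Nat.card {d' : D // M.face d' = M.face d} = Function.minimalPeriod M.facePerm d := by
  have h := Nat.card_congr (Equiv.ofBijective _ (M.facePerm.bijective_iterate_sameCycle hd))
  rw [Nat.card_fin] at h
  rw [h]
  exact Nat.card_congr (Equiv.subtypeEquivRight fun b => by rw [eq_comm, face_eq_iff])

theorem card_darts_edge (M : CombMap D) (d : D) :
    Nat.card {d' : D // M.edge d' = M.edge d} = 2 := by
  have h : {d' : D | M.edge d' = M.edge d} = {d, M.rev d} := by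
    ext a
    change M.edge a = M.edge d ↔ a = d ∨ a = M.rev d
    rw [eq_comm, edge_eq_iff]
  change Nat.card ({d' : D | M.edge d' = M.edge d} : Set D) = 2
  rw [h, Nat.card_coe_set_eq, Set.ncard_pair (M.rev_ne d).symm]

/-- A criterion for the dual of `E₁₃` in terms of darts: `lam` gives the vertex of `H` for the darts
at vertices of colour `1`, and `δ` gives the dart from colour `2` to colour `0` that crosses an
edge of `H`. -/
theorem HasLatticeDual.of_darts {M : CombMap D} {n₁ n₂ n₃ : ℕ} {H : Multigraph}
    (hT : M.IsTriangulation) (c : M.Vertex → Fin 3) (hc : M.IsProper c)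
    (h₁ : Even n₁) (h₂ : Even n₂) (h₃ : Even n₃) (hdeg : ∀ v, M.degree v = ![n₁, n₂, n₃] (c v))
    (lam : D → H.V) (hlam : ∀ a b, c (M.vert a) = 1 → c (M.vert b) = 1 →
      (lam a = lam b ↔ M.vert a = M.vert b))
    (hsurj : ∀ x, ∃ d, c (M.vert d) = 1 ∧ lam d = x) (δ : H.E → D)
    (hδ : Function.Injective δ)
    (hrange : ∀ d, (c (M.vert d) = 2 ∧ c (M.vert (M.rev d)) = 0) ↔ ∃ e, δ e = d)
    (hends : ∀ e, H.ends e =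
      s(lam (M.rev (M.rot.symm (δ e))), lam (M.rev (M.rot (δ e))))) :
    M.HasLatticeDual n₁ n₂ n₃ H := by
  refine ⟨hT, fun v => ?_, c, hc, hdeg, ?_⟩
  · rw [hdeg]
    generalize c v = i
    fin_cases i <;> assumption
  have hβ : ∃ β : {v : M.Vertex // c v = 1} ≃ H.V, ∀ d hd, β ⟨M.vert d, hd⟩ = lam d := by
    let f : {v : M.Vertex // c v = 1} → H.V := fun v => lam (M.vert_surjective v.1).choose
    have hf : ∀ d hd, f ⟨M.vert d, hd⟩ = lam d := by
      intro d hd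
      have h := (M.vert_surjective (M.vert d)).choose_spec
      exact (hlam _ _ (by rw [h]; exact hd) hd).2 h
    refine ⟨Equiv.ofBijective f ⟨?_, ?_⟩, hf⟩
    · rintro ⟨v, hv⟩ ⟨w, hw⟩ h
      obtain ⟨a, rfl⟩ := M.vert_surjective v
      obtain ⟨b, rfl⟩ := M.vert_surjective w
      rw [hf, hf, hlam a b hv hw] at h
      exact Subtype.ext h
    · intro x
      obtain ⟨d, hd, rfl⟩ := hsurj x
      exact ⟨⟨M.vert d, hd⟩, hf d hd⟩
  obtain ⟨β, hβ⟩ := hβ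
  let ε : H.E ≃ M.CrossDart c := Equiv.ofBijective (fun e => ⟨δ e, (hrange _).2 ⟨e, rfl⟩⟩)
    ⟨fun a b h => hδ (Subtype.ext_iff.1 h), fun d => by
      obtain ⟨e, he⟩ := (hrange d.1).1 d.2
      exact ⟨e, Subtype.ext he⟩⟩
  refine ⟨⟨(starFaceEquiv hc hT).symm.trans β, (M.crossEquiv c).symm.trans ε.symm, ?_⟩, β, ?_⟩
  · intro x
    obtain ⟨a, rfl⟩ := (M.crossEquiv c).surjective x
    obtain ⟨e, rfl⟩ := ε.surjective a
    obtain ⟨k1, k2⟩ : c (M.vert (δ e)) = 2 ∧ c (M.vert (M.rev (δ e))) = 0 := (ε e).2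
    obtain ⟨h1, h2, h3⟩ := hc.star_colours hT (δ e)
    obtain ⟨h1', h2', h3'⟩ := hc.star_colours hT (M.rot.symm (δ e))
    rw [Equiv.apply_symm_apply] at h2' h3'
    rw [vert_rot_symm] at h1' h2'
    -- The faces to the right and left of `δ e` are the corners before and after it in the rotation.
    -- Since `δ e` joins colours `2` and `0`, the third vertices of these triangles are the far ends
    -- of the neighbouring darts.
    have m1 : M.mid c (δ e) = M.vert (M.rev (M.rot.symm (δ e))) := by
      rw [← M.rot.apply_symm_apply (δ e), hc.mid_rot hT, M.rot.apply_symm_apply]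
      exact mid_of_vert (by omega)
    have m2 : M.mid c (M.rev (δ e)) = M.vert (M.rev (M.rot (δ e))) := by
      rw [← hc.mid_rot hT]
      exact hc.mid_of_vert_rev (by omega)
    have l1 : β ⟨M.mid c (δ e), hc.colour_mid hT _⟩ = lam (M.rev (M.rot.symm (δ e))) := by
      rw [← hβ _ (m1 ▸ hc.colour_mid hT (δ e))]
      exact congrArg β (Subtype.ext m1)
    have l2 : β ⟨M.mid c (M.rev (δ e)), hc.colour_mid hT _⟩ = lam (M.rev (M.rot (δ e))) := by
      rw [← hβ _ (m2 ▸ hc.colour_mid hT (M.rev (δ e)))]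
      exact congrArg β (Subtype.ext m2)
    have he : ((M.crossEquiv c).symm.trans ε.symm) (M.crossEquiv c (ε e)) = e := by simp
    refine (congrArg H.ends he).trans ?_
    rw [hends, ← l1, ← l2, dualSub_ends_crossEquiv hc hT, Sym2.map_mk, Equiv.trans_apply,
      Equiv.trans_apply, Equiv.symm_apply_apply, Equiv.symm_apply_apply]
    rfl
  · intro d hd
    change β ((starFaceEquiv hc hT).symm _) = _
    rw [← hc.starFace_vert d hd]
    exact congrArg β ((starFaceEquiv hc hT).symm_apply_apply _)

/-! ### The subdivision of a map -/

section Subdiv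

open SubdivDart

variable (M : CombMap D)

@[simp] theorem subdiv_rot_ve (d : D) : M.subdiv.rot (ve d) = vf (M.rot d) := rfl

@[simp] theorem subdiv_rot_vf (d : D) : M.subdiv.rot (vf d) = ve d := rfl

@[simp] theorem subdiv_rot_ev (d : D) : M.subdiv.rot (ev d) = ef d := rfl

@[simp] theorem subdiv_rot_ef (d : D) : M.subdiv.rot (ef d) = ev (M.rev d) := rfl

@[simp] theorem subdiv_rot_fe (d : D) : M.subdiv.rot (fe d) = fv d := rfl

@[simp] theorem subdiv_rot_fv (d : D) : M.subdiv.rot (fv d) = fe (M.facePerm.symm d) := rfl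

@[simp] theorem subdiv_rev_ve (d : D) : M.subdiv.rev (ve d) = ev d := rfl

@[simp] theorem subdiv_rev_ev (d : D) : M.subdiv.rev (ev d) = ve d := rfl

@[simp] theorem subdiv_rev_fe (d : D) : M.subdiv.rev (fe d) = ef d := rfl

@[simp] theorem subdiv_rev_ef (d : D) : M.subdiv.rev (ef d) = fe d := rfl

@[simp] theorem subdiv_rev_vf (d : D) : M.subdiv.rev (vf d) = fv d := rfl

@[simp] theorem subdiv_rev_fv (d : D) : M.subdiv.rev (fv d) = vf d := rfl

/-- The vertex, face or edge of a map at which a dart of the subdivision starts. -/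
def subdivCell : SubdivDart D → M.Vertex ⊕ M.Face ⊕ M.Edge
  | ve d => Sum.inl (M.vert d)
  | vf d => Sum.inl (M.vert d)
  | fe d => Sum.inr (Sum.inl (M.face d))
  | fv d => Sum.inr (Sum.inl (M.face d))
  | ev d => Sum.inr (Sum.inr (M.edge d))
  | ef d => Sum.inr (Sum.inr (M.edge d))

theorem face_facePerm_symm (d : D) : M.face (M.facePerm.symm d) = M.face d := by
  rw [← face_facePerm, Equiv.apply_symm_apply]

theorem subdivCell_rot (x : SubdivDart D) : M.subdivCell (M.subdiv.rot x) = M.subdivCell x := by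
  cases x <;> simp [subdivCell, face_facePerm_symm]

/-- The vertices of the subdivision are the vertices, faces and edges of the map. -/
def subdivVertex : M.subdiv.Vertex → M.Vertex ⊕ M.Face ⊕ M.Edge :=
  Quotient.lift M.subdivCell fun _ _ h => Equiv.Perm.SameCycle.apply_eq M.subdivCell_rot h

@[simp] theorem subdivVertex_vert (x : SubdivDart D) :
    M.subdivVertex (M.subdiv.vert x) = M.subdivCell x := rfl

theorem subdiv_vert_vf (d : D) : M.subdiv.vert (vf d) = M.subdiv.vert (ve d) :=
  (M.subdiv.vert_rot (vf d)).symm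

theorem subdiv_vert_ef (d : D) : M.subdiv.vert (ef d) = M.subdiv.vert (ev d) :=
  M.subdiv.vert_rot (ev d)

theorem subdiv_vert_fv (d : D) : M.subdiv.vert (fv d) = M.subdiv.vert (fe d) :=
  M.subdiv.vert_rot (fe d)

theorem subdiv_vert_ve_eq {a b : D} (h : M.vert a = M.vert b) :
    M.subdiv.vert (ve a) = M.subdiv.vert (ve b) :=
  (M.vert_eq_iff.1 h).apply_eq (f := fun d => M.subdiv.vert (ve d)) fun d => by
    rw [← subdiv_vert_vf]
    exact M.subdiv.vert_rot (ve d)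

theorem subdiv_vert_fe_eq {a b : D} (h : M.face a = M.face b) :
    M.subdiv.vert (fe a) = M.subdiv.vert (fe b) :=
  (M.face_eq_iff.1 h).apply_eq (f := fun d => M.subdiv.vert (fe d)) fun d => by
    have := M.subdiv.vert_rot (fv (M.facePerm d))
    rw [subdiv_vert_fv] at this
    rw [← this]
    exact congrArg (fun d => M.subdiv.vert (fe d)) (M.facePerm.symm_apply_apply d)

theorem subdiv_vert_ev_eq {a b : D} (h : M.edge a = M.edge b) :
    M.subdiv.vert (ev a) = M.subdiv.vert (ev b) := by
  rcases M.edge_eq_iff.1 h with rfl | rfl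
  · rfl
  · rw [← subdiv_vert_ef]
    exact (M.subdiv.vert_rot (ef a)).symm

/-- Rotation preserves the cell. Conversely, it alternates between the two kinds of darts at a cell,
and two rotations move the underlying dart one step, up to direction, along the orbit that defines
the cell. -/
theorem subdiv_vert_eq_iff {x y : SubdivDart D} :
    M.subdiv.vert x = M.subdiv.vert y ↔ M.subdivCell x = M.subdivCell y := by
  constructor
  · exact fun h => congrArg M.subdivVertex h
  · cases x <;> cases y <;> intro h <;>
      simp only [subdivCell, Sum.inl.injEq, Sum.inr.injEq, reduceCtorEq] at h <;>
      (try simp only [subdiv_vert_vf, subdiv_vert_ef, subdiv_vert_fv]) <;>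
      first
        | exact M.subdiv_vert_ve_eq h
        | exact M.subdiv_vert_fe_eq h
        | exact M.subdiv_vert_ev_eq h

/-- The triangles are the flags of the map: each has one corner at a vertex, one at an edge and one
at a face. -/
theorem subdiv_isTriangulation : M.subdiv.IsTriangulation where
  loopless := by
    intro x h
    rw [subdiv_vert_eq_iff] at h
    cases x <;> simp [subdivCell] at h
  triangle := by
    have hs : ∀ d, M.facePerm.symm (M.rot d) = M.rev d := by
      intro d
      rw [Equiv.symm_apply_eq, facePerm_apply, M.rev_rev]
    have hs' : ∀ d, M.rot (M.rev (M.facePerm.symm d)) = d := fun d => M.facePerm.apply_symm_apply d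
    intro x
    cases x <;> simp [facePerm_apply M.subdiv, M.rev_rev, hs, hs']

/-- The colouring of the vertices, faces and edges of a map by three colours. -/
def subdivColour (i j k : Fin 3) (v : M.subdiv.Vertex) : Fin 3 :=
  Sum.elim (fun _ => i) (Sum.elim (fun _ => j) fun _ => k) (M.subdivVertex v)

theorem subdivColour_isProper {i j k : Fin 3} (hij : i ≠ j) (hjk : j ≠ k) (hik : i ≠ k) :
    M.subdiv.IsProper (M.subdivColour i j k) := by
  intro x
  cases x <;> simp [subdivColour, subdivCell, hij, hjk, hik, hij.symm, hjk.symm, hik.symm]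

/-- This gives the degrees in the subdivision: each dart of the original map in a cell yields two
darts there. -/
theorem Nat.card_subtype_eq_two_mul {α β : Type*} {P : α → Prop} {Q : β → Prop} {g h : β → α}
    (hg : Function.Injective g) (hh : Function.Injective h) (hgh : ∀ a b, g a ≠ h b)
    (hP : ∀ x, P x ↔ ∃ d, Q d ∧ (x = g d ∨ x = h d)) :
    Nat.card {x // P x} = 2 * Nat.card {d // Q d} := by
  have e : {d // Q d} × Bool ≃ {x // P x} := Equiv.ofBijective
    (fun d => ⟨if d.2 then g d.1 else h d.1, (hP _).2 ⟨d.1, d.1.2, by split_ifs <;> simp⟩⟩) (by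
      constructor
      · rintro ⟨⟨a, ha⟩, x⟩ ⟨⟨b, hb⟩, y⟩ hab
        have hab := Subtype.ext_iff.1 hab
        cases x <;> cases y <;> simp only [if_true, Bool.false_eq_true, if_false] at hab
        · obtain rfl := hh hab
          rfl
        · exact absurd hab.symm (hgh _ _)
        · exact absurd hab (hgh _ _)
        · obtain rfl := hg hab
          rfl
      · rintro ⟨x, hx⟩
        obtain ⟨d, hd, rfl | rfl⟩ := (hP x).1 hx
        · exact ⟨(⟨d, hd⟩, true), rfl⟩
        · exact ⟨(⟨d, hd⟩, false), rfl⟩)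
  rw [← Nat.card_congr e, Nat.card_prod, Nat.card_eq_fintype_card (α := Bool), Fintype.card_bool,
    mul_comm]

theorem subdiv_degree_ve (d : D) :
    M.subdiv.degree (M.subdiv.vert (ve d)) = 2 * M.degree (M.vert d) := by
  refine Nat.card_subtype_eq_two_mul (g := ve) (h := vf) (fun a b h => by simpa using h)
    (fun a b h => by simpa using h) (fun a b h => by simp at h) fun x => ?_
  rw [subdiv_vert_eq_iff]
  cases x <;> simp [subdivCell]

theorem subdiv_degree_fe (d : D) :
    M.subdiv.degree (M.subdiv.vert (fe d)) = 2 * Nat.card {d' // M.face d' = M.face d} := by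
  refine Nat.card_subtype_eq_two_mul (g := fe) (h := fv) (fun a b h => by simpa using h)
    (fun a b h => by simpa using h) (fun a b h => by simp at h) fun x => ?_
  rw [subdiv_vert_eq_iff]
  cases x <;> simp [subdivCell]

theorem subdiv_degree_ev (d : D) : M.subdiv.degree (M.subdiv.vert (ev d)) = 4 := by
  rw [show 4 = 2 * Nat.card {d' // M.edge d' = M.edge d} by rw [card_darts_edge]]
  refine Nat.card_subtype_eq_two_mul (g := ev) (h := ef) (fun a b h => by simpa using h)
    (fun a b h => by simpa using h) (fun a b h => by simp at h) fun x => ?_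
  rw [subdiv_vert_eq_iff]
  cases x <;> simp [subdivCell]

variable {M} {n m : ℕ}

theorem subdiv_degree (hn : ∀ v, M.degree v = n)
    (hm : ∀ d, Nat.card {d' // M.face d' = M.face d} = m)
    {i j k : Fin 3} {w : Fin 3 → ℕ} (hi : w i = 2 * n) (hj : w j = 2 * m)
    (hk : w k = 4) (v : M.subdiv.Vertex) : M.subdiv.degree v = w (M.subdivColour i j k v) := by
  obtain ⟨x, rfl⟩ := M.subdiv.vert_surjective v
  cases x <;> simp [subdivColour, subdivCell, subdiv_vert_vf, subdiv_vert_ef, subdiv_vert_fv,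
    subdiv_degree_ve, subdiv_degree_fe, subdiv_degree_ev, hn, hm, hi, hj, hk]

/-- The argument of the darts of the subdivision. -/
def subdivBase : SubdivDart D → D
  | ve d => d
  | vf d => d
  | fe d => d
  | fv d => d
  | ev d => d
  | ef d => d

/-- The dual of the face-edge graph of a map is the map itself with doubled edges. -/
theorem subdiv_hasLatticeDual_vertices (hn : ∀ v, M.degree v = n)
    (hm : ∀ d, Nat.card {d' // M.face d' = M.face d} = m)
    {H : Multigraph} (lam : D → H.V)
    (hlam : ∀ a b, lam a = lam b ↔ M.vert a = M.vert b) (hsurj : Function.Surjective lam)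
    (δ : H.E → D) (hδ : Function.Bijective δ)
    (hends : ∀ e, H.ends e = s(lam (δ e), lam (M.rev (δ e)))) :
    M.subdiv.HasLatticeDual (2 * m) (2 * n) 4 H := by
  refine HasLatticeDual.of_darts M.subdiv_isTriangulation (M.subdivColour 1 0 2)
    (M.subdivColour_isProper (by decide) (by decide) (by decide)) (even_two_mul _)
    (even_two_mul _) (by decide) (subdiv_degree hn hm rfl rfl rfl) (fun x => lam (subdivBase x)) ?_ ?_
    -- The neighbours of `ef d` in the rotation are `ev d` and `ev (rev d)`, which lead to the two
    -- ends of the edge. The darts `d` and `rev d` give two parallel dual edges.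
    (fun e => ef (δ e)) (fun a b h => hδ.1 (by simpa using h)) ?_ hends
  · intro a b ha hb
    rw [hlam, subdiv_vert_eq_iff]
    cases a <;> cases b <;> simp_all [subdivColour, subdivCell, subdivBase]
  · intro x
    obtain ⟨d, rfl⟩ := hsurj x
    exact ⟨ve d, rfl, rfl⟩
  · intro x
    cases x <;> simp [subdivColour, subdivCell, hδ.2 _]

/-- The dual of the vertex-edge graph of a map is the dual map with doubled edges. -/
theorem subdiv_hasLatticeDual_faces (hn : ∀ v, M.degree v = n)
    (hm : ∀ d, Nat.card {d' // M.face d' = M.face d} = m)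
    {H : Multigraph} (lam : D → H.V)
    (hlam : ∀ a b, lam a = lam b ↔ M.face a = M.face b) (hsurj : Function.Surjective lam)
    (δ : H.E → D) (hδ : Function.Bijective δ)
    (hends : ∀ e, H.ends e = s(lam (M.rev (δ e)), lam (δ e))) :
    M.subdiv.HasLatticeDual (2 * n) (2 * m) 4 H := by
  refine HasLatticeDual.of_darts M.subdiv_isTriangulation (M.subdivColour 0 1 2)
    (M.subdivColour_isProper (by decide) (by decide) (by decide)) (even_two_mul _)
    (even_two_mul _) (by decide) (subdiv_degree hn hm rfl rfl rfl) (fun x => lam (subdivBase x)) ?_ ?_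
    -- The neighbours of `ev d` are `ef (rev d)` and `ef d`, which lead to the two faces at the
    -- edge.
    (fun e => ev (δ e)) (fun a b h => hδ.1 (by simpa using h)) ?_ hends
  · intro a b ha hb
    rw [hlam, subdiv_vert_eq_iff]
    cases a <;> cases b <;> simp_all [subdivColour, subdivCell, subdivBase]
  · intro x
    obtain ⟨d, rfl⟩ := hsurj x
    exact ⟨fe d, rfl, rfl⟩
  · intro x
    cases x <;> simp [subdivColour, subdivCell, hδ.2 _]

/-- The dual of the vertex-face graph of a map is its medial graph. -/
theorem subdiv_hasLatticeDual_edges (hn : ∀ v, M.degree v = n)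
    (hm : ∀ d, Nat.card {d' // M.face d' = M.face d} = m)
    {H : Multigraph} (lam : D → H.V)
    (hlam : ∀ a b, lam a = lam b ↔ M.edge a = M.edge b) (hsurj : Function.Surjective lam)
    (δ : H.E → D) (hδ : Function.Bijective δ)
    (hends : ∀ e, H.ends e = s(lam (δ e), lam (M.facePerm.symm (δ e)))) :
    M.subdiv.HasLatticeDual (2 * n) 4 (2 * m) H := by
  refine HasLatticeDual.of_darts M.subdiv_isTriangulation (M.subdivColour 0 2 1)
    (M.subdivColour_isProper (by decide) (by decide) (by decide)) (even_two_mul _)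
    (by decide) (even_two_mul _) (subdiv_degree hn hm rfl rfl rfl) (fun x => lam (subdivBase x)) ?_ ?_
    -- The neighbours of `fv d` are `fe d` and `fe (facePerm.symm d)`, which lead to consecutive
    -- edges of the face.
    (fun e => fv (δ e)) (fun a b h => hδ.1 (by simpa using h)) ?_ hends
  · intro a b ha hb
    rw [hlam, subdiv_vert_eq_iff]
    cases a <;> cases b <;> simp_all [subdivColour, subdivCell, subdivBase]
  · intro x
    obtain ⟨d, rfl⟩ := hsurj x
    exact ⟨ev d, rfl, rfl⟩
  · intro x
    cases x <;> simp [subdivColour, subdivCell, hδ.2 _]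

end Subdiv

end CombMap

namespace CombMap

/-! ### Lattices with the same directions at all sites -/

section OfDirections

variable {n : ℕ} [NeZero n] (dir : Fin n → ℤ × ℤ) (m : Fin n)
  (hm : m + m = 0) (hm0 : m ≠ 0) (hdir : ∀ k, dir (k + m) = -dir k)

open Fin.NatCast in
theorem ofDirections_vert_eq_iff {a b : (ℤ × ℤ) × Fin n} :
    (ofDirections dir m hm hm0 hdir).vert a = (ofDirections dir m hm hm0 hdir).vert b ↔
      a.1 = b.1 := by
  constructor
  · exact fun h => ((vert_eq_iff _).1 h).apply_eq fun _ => rfl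
  · obtain ⟨v, k⟩ := a
    obtain ⟨w, l⟩ := b
    rintro rfl
    have h : ∀ j : ℕ, (ofDirections dir m hm hm0 hdir).vert (v, k + (j : Fin n)) =
        (ofDirections dir m hm hm0 hdir).vert (v, k) := by
      intro j
      induction j with
      | zero => simp
      | succ j ih =>
        rw [← ih, Nat.cast_succ, ← add_assoc]
        exact vert_rot _ (v, k + (j : Fin n))
    -- Each rotation raises the direction by one, so `l - k` rotations lead from direction `k` to
    -- `l`.
    have := h (l - k).val
    rw [Fin.cast_val_eq_self, add_sub_cancel] at this
    exact this.symm

theorem ofDirections_degree (v : (ofDirections dir m hm hm0 hdir).Vertex) :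
    (ofDirections dir m hm hm0 hdir).degree v = n := by
  obtain ⟨d, rfl⟩ := vert_surjective _ v
  have e : {d' // (ofDirections dir m hm hm0 hdir).vert d' =
      (ofDirections dir m hm hm0 hdir).vert d} ≃ Fin n :=
    { toFun := fun d' => d'.1.2
      invFun := fun k => ⟨(d.1, k), (ofDirections_vert_eq_iff dir m hm hm0 hdir).2 rfl⟩
      left_inv := fun d' => Subtype.ext
        (Prod.ext ((ofDirections_vert_eq_iff dir m hm hm0 hdir).1 d'.2).symm rfl)
      right_inv := fun k => rfl }
  rw [degree, Nat.card_congr e, Nat.card_fin]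

end OfDirections

/-! ### The square lattice -/

theorem square_rev (v : ℤ × ℤ) (k : Fin 4) :
    square.rev (v, k) = (v + ![(1, 0), (0, 1), (-1, 0), (0, -1)] k, k + 2) := rfl

theorem square_facePerm (v : ℤ × ℤ) (k : Fin 4) :
    square.facePerm (v, k) = (v + ![(1, 0), (0, 1), (-1, 0), (0, -1)] k, k + 2 + 1) := rfl

theorem square_card_face (d : (ℤ × ℤ) × Fin 4) :
    Nat.card {d' // square.face d' = square.face d} = 4 := by
  -- As a prime power, the period `4` needs only two checks: four steps return to the start and two
  -- steps do not.
  have h : Function.minimalPeriod square.facePerm d = 2 ^ (1 + 1) := by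
    refine Function.minimalPeriod_eq_prime_pow ?_ ?_
    all_goals
      obtain ⟨⟨x, y⟩, k⟩ := d
      fin_cases k <;> simp [Function.IsPeriodicPt, Function.IsFixedPt, square_facePerm,
        Fin.ext_iff]
  rw [card_darts_face _ _ (by rw [h]; norm_num), h]
  rfl

/-- The darts of the square lattice, given by an edge and an orientation. -/
def squareDart (e : ((ℤ × ℤ) × Fin 2) × Bool) : (ℤ × ℤ) × Fin 4 :=
  if e.2 then (e.1.1, ![0, 1] e.1.2)
  else (e.1.1 + ![(1, 0), (0, 1)] e.1.2, ![2, 3] e.1.2)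

theorem squareDart_bijective : Function.Bijective squareDart := by
  constructor
  · rintro ⟨⟨⟨x, y⟩, k⟩, b⟩ ⟨⟨⟨x', y'⟩, k'⟩, b'⟩ h
    fin_cases k <;> fin_cases k' <;> cases b <;> cases b' <;>
      simp_all [squareDart, Fin.ext_iff]
  · rintro ⟨⟨x, y⟩, k⟩
    fin_cases k
    · exact ⟨(((x, y), 0), true), by simp [squareDart]⟩
    · exact ⟨(((x, y), 1), true), by simp [squareDart]⟩
    · exact ⟨(((x - 1, y), 0), false), by simp [squareDart]⟩
    · exact ⟨(((x, y - 1), 1), false), by simp [squareDart]⟩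

theorem squareDart_ends (e : ((ℤ × ℤ) × Fin 2) × Bool) :
    s(e.1.1, e.1.1 + ![(1, 0), (0, 1)] e.1.2) =
      s((squareDart e).1, (square.rev (squareDart e)).1) := by
  obtain ⟨⟨⟨x, y⟩, k⟩, b⟩ := e
  fin_cases k <;> cases b <;> simp [squareDart, square_rev]

theorem unionJack_hasLatticeDual :
    unionJack.HasLatticeDual 8 8 4 Multigraph.squareLattice.doubled := by
  exact subdiv_hasLatticeDual_vertices (n := 4) (m := 4) (ofDirections_degree _ _ _ _ _)
    square_card_face (H := Multigraph.squareLattice.doubled) Prod.fst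
    (fun a b => (ofDirections_vert_eq_iff _ _ _ _ _).symm)
    (fun x => ⟨(x, 0), rfl⟩) squareDart squareDart_bijective squareDart_ends

/-! ### The triangular lattice -/

theorem triangular_rot (v : ℤ × ℤ) (k : Fin 6) : triangular.rot (v, k) = (v, k + 1) := rfl

theorem triangular_rot_symm (v : ℤ × ℤ) (k : Fin 6) :
    triangular.rot.symm (v, k) = (v, k - 1) := by
  rw [Equiv.symm_apply_eq, triangular_rot, sub_add_cancel]

theorem triangular_rev (v : ℤ × ℤ) (k : Fin 6) : triangular.rev (v, k) =
    (v + ![(1, 0), (0, 1), (-1, 1), (-1, 0), (0, -1), (1, -1)] k, k + 3) := rfl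

theorem triangular_facePerm (v : ℤ × ℤ) (k : Fin 6) : triangular.facePerm (v, k) =
    (v + ![(1, 0), (0, 1), (-1, 1), (-1, 0), (0, -1), (1, -1)] k, k + 3 + 1) := rfl

theorem triangular_vert_eq_iff {a b : (ℤ × ℤ) × Fin 6} :
    triangular.vert a = triangular.vert b ↔ a.1 = b.1 :=
  ofDirections_vert_eq_iff _ _ _ _ _

theorem triangular_degree (v : triangular.Vertex) : triangular.degree v = 6 :=
  ofDirections_degree _ _ _ _ _ v

theorem triangular_isTriangulation : triangular.IsTriangulation where
  loopless := by
    rintro ⟨⟨x, y⟩, k⟩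
    rw [Ne, triangular_vert_eq_iff]
    fin_cases k <;> simp [triangular_rev]
  triangle := by
    rintro ⟨⟨x, y⟩, k⟩
    fin_cases k <;> simp [triangular_facePerm, Fin.ext_iff]

theorem triangular_card_face (d : (ℤ × ℤ) × Fin 6) :
    Nat.card {d' // triangular.face d' = triangular.face d} = 3 := by
  have h := triangular_isTriangulation.minimalPeriod_facePerm d
  rw [card_darts_face _ _ (by omega), h]

/-- The darts of the triangular lattice, given by an edge and an orientation. -/
def triangularDart (e : ((ℤ × ℤ) × Fin 3) × Bool) : (ℤ × ℤ) × Fin 6 :=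
  if e.2 then (e.1.1, ![0, 1, 2] e.1.2)
  else (e.1.1 + ![(1, 0), (0, 1), (-1, 1)] e.1.2, ![3, 4, 5] e.1.2)

theorem triangularDart_bijective : Function.Bijective triangularDart := by
  constructor
  · rintro ⟨⟨⟨x, y⟩, k⟩, b⟩ ⟨⟨⟨x', y'⟩, k'⟩, b'⟩ h
    fin_cases k <;> fin_cases k' <;> cases b <;> cases b' <;>
      simp_all [triangularDart, Fin.ext_iff]
  · rintro ⟨⟨x, y⟩, k⟩
    fin_cases k
    · exact ⟨(((x, y), 0), true), by simp [triangularDart]⟩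
    · exact ⟨(((x, y), 1), true), by simp [triangularDart]⟩
    · exact ⟨(((x, y), 2), true), by simp [triangularDart]⟩
    · exact ⟨(((x - 1, y), 0), false), by simp [triangularDart]⟩
    · exact ⟨(((x, y - 1), 1), false), by simp [triangularDart]⟩
    · exact ⟨(((x + 1, y - 1), 2), false), by simp [triangularDart]⟩

theorem triangularDart_ends (e : ((ℤ × ℤ) × Fin 3) × Bool) :
    s(e.1.1, e.1.1 + ![(1, 0), (0, 1), (-1, 1)] e.1.2) =
      s((triangularDart e).1, (triangular.rev (triangularDart e)).1) := by
  obtain ⟨⟨⟨x, y⟩, k⟩, b⟩ := e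
  fin_cases k <;> cases b <;> simp [triangularDart, triangular_rev]

theorem bisectedHexagonal_hasLatticeDual_triangular :
    bisectedHexagonal.HasLatticeDual 6 12 4 Multigraph.triangularLattice.doubled := by
  exact subdiv_hasLatticeDual_vertices triangular_degree triangular_card_face
    (H := Multigraph.triangularLattice.doubled) Prod.fst (fun a b => triangular_vert_eq_iff.symm)
    (fun x => ⟨(x, 0), rfl⟩) triangularDart triangularDart_bijective triangularDart_ends

/-- The site of the hexagonal lattice in the face to the right of a dart of the triangular
lattice. -/
def triangularFaceSite (d : (ℤ × ℤ) × Fin 6) : (ℤ × ℤ) × Bool :=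
  (d.1 - ![(0, 1), (0, 0), (1, 0), (1, 0), (1, 1), (0, 1)] d.2,
    ![true, false, true, false, true, false] d.2)

theorem triangularFaceSite_facePerm (d : (ℤ × ℤ) × Fin 6) :
    triangularFaceSite (triangular.facePerm d) = triangularFaceSite d := by
  obtain ⟨⟨x, y⟩, k⟩ := d
  fin_cases k <;> simp [triangularFaceSite, triangular_facePerm] <;> omega

theorem triangularFaceSite_eq_iff (a b : (ℤ × ℤ) × Fin 6) :
    triangularFaceSite a = triangularFaceSite b ↔ triangular.face a = triangular.face b := by
  constructor
  -- One dart is chosen on each triangle. Any dart of the triangle is this one, or comes just before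
  -- or just after it.
  · let rep : (ℤ × ℤ) × Bool → (ℤ × ℤ) × Fin 6 :=
      fun x => if x.2 then (x.1 + (1, 1), 4) else (x.1, 1)
    have hrep : ∀ d, triangular.face (rep (triangularFaceSite d)) = triangular.face d := by
      rintro ⟨⟨x, y⟩, k⟩
      have h : rep (triangularFaceSite ((x, y), k)) = ((x, y), k) ∨
          rep (triangularFaceSite ((x, y), k)) = triangular.facePerm ((x, y), k) ∨
          triangular.facePerm (rep (triangularFaceSite ((x, y), k))) = ((x, y), k) := by
        fin_cases k <;> simp [rep, triangularFaceSite, triangular_facePerm, Fin.ext_iff]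
        omega
      rcases h with h | h | h
      · rw [h]
      · rw [h, face_facePerm]
      · rw [← face_facePerm, h]
    intro h
    rw [← hrep a, h, hrep]
  · exact fun h => ((face_eq_iff _).1 h).apply_eq triangularFaceSite_facePerm

/-- The darts of the triangular lattice, given by the edge of the hexagonal lattice that they
cross and an orientation. -/
def hexagonalDart (e : ((ℤ × ℤ) × Fin 3) × Bool) : (ℤ × ℤ) × Fin 6 :=
  if e.2 then (e.1.1 + ![(0, 1), (0, 0), (1, 0)] e.1.2, ![5, 1, 3] e.1.2)
  else (e.1.1 + ![(1, 0), (0, 1), (0, 0)] e.1.2, ![2, 4, 0] e.1.2)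

theorem hexagonalDart_bijective : Function.Bijective hexagonalDart := by
  constructor
  · rintro ⟨⟨⟨x, y⟩, k⟩, b⟩ ⟨⟨⟨x', y'⟩, k'⟩, b'⟩ h
    fin_cases k <;> fin_cases k' <;> cases b <;> cases b' <;>
      simp_all [hexagonalDart, Fin.ext_iff]
  · rintro ⟨⟨x, y⟩, k⟩
    fin_cases k
    · exact ⟨(((x, y), 2), false), by simp [hexagonalDart]⟩
    · exact ⟨(((x, y), 1), true), by simp [hexagonalDart]⟩
    · exact ⟨(((x - 1, y), 0), false), by simp [hexagonalDart]⟩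
    · exact ⟨(((x - 1, y), 2), true), by simp [hexagonalDart]⟩
    · exact ⟨(((x, y - 1), 1), false), by simp [hexagonalDart]⟩
    · exact ⟨(((x, y - 1), 0), true), by simp [hexagonalDart]⟩

theorem triangularFaceSite_surjective : Function.Surjective triangularFaceSite := by
  rintro ⟨⟨x, y⟩, b⟩
  cases b
  · exact ⟨((x, y), 1), by simp [triangularFaceSite]⟩
  · exact ⟨((x, y + 1), 0), by simp [triangularFaceSite]⟩

theorem hexagonalDart_ends (e : ((ℤ × ℤ) × Fin 3) × Bool) :
    s((e.1.1, false), (e.1.1 - ![(0, 0), (1, 0), (0, 1)] e.1.2, true)) =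
      s(triangularFaceSite (triangular.rev (hexagonalDart e)),
        triangularFaceSite (hexagonalDart e)) := by
  obtain ⟨⟨⟨x, y⟩, k⟩, b⟩ := e
  fin_cases k <;> cases b <;> simp [hexagonalDart, triangular_rev, triangularFaceSite]

theorem bisectedHexagonal_hasLatticeDual_hexagonal :
    bisectedHexagonal.HasLatticeDual 12 6 4 Multigraph.hexagonalLattice.doubled :=
  subdiv_hasLatticeDual_faces triangular_degree triangular_card_face
    (H := Multigraph.hexagonalLattice.doubled) triangularFaceSite triangularFaceSite_eq_iff
    triangularFaceSite_surjective hexagonalDart hexagonalDart_bijective hexagonalDart_ends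

/-- The site of the kagome lattice on the edge of the triangular lattice that carries a dart. -/
def triangularEdgeSite (d : (ℤ × ℤ) × Fin 6) : (ℤ × ℤ) × Fin 3 :=
  (d.1 - ![(0, 1), (1, 0), (1, 0), (1, 1), (1, 1), (0, 1)] d.2, ![2, 1, 0, 2, 1, 0] d.2)

theorem triangularEdgeSite_eq_iff (a b : (ℤ × ℤ) × Fin 6) :
    triangularEdgeSite a = triangularEdgeSite b ↔ triangular.edge a = triangular.edge b := by
  rw [edge_eq_iff]
  obtain ⟨⟨x, y⟩, k⟩ := a
  obtain ⟨⟨x', y'⟩, k'⟩ := b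
  fin_cases k <;> fin_cases k' <;>
    simp [triangularEdgeSite, triangular_rev, Fin.ext_iff] <;> omega

/-- The dart of the triangular lattice that bounds the face around a triangle of the kagome
lattice and starts opposite to a corner of this triangle. -/
def kagomeDart (e : ((ℤ × ℤ) × Bool) × Fin 3) : (ℤ × ℤ) × Fin 6 :=
  if e.1.2 then (e.1.1 + ![(1, 1), (0, 1), (1, 0)] e.2, ![4, 0, 2] e.2)
  else (e.1.1 + ![(0, 0), (1, 0), (0, 1)] e.2, ![1, 3, 5] e.2)

theorem kagomeDart_bijective : Function.Bijective kagomeDart := by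
  constructor
  · rintro ⟨⟨⟨x, y⟩, b⟩, k⟩ ⟨⟨⟨x', y'⟩, b'⟩, k'⟩ h
    fin_cases k <;> fin_cases k' <;> cases b <;> cases b' <;>
      simp_all [kagomeDart, Fin.ext_iff]
  · rintro ⟨⟨x, y⟩, k⟩
    fin_cases k
    · exact ⟨(((x, y - 1), true), 1), by simp [kagomeDart]⟩
    · exact ⟨(((x, y), false), 0), by simp [kagomeDart]⟩
    · exact ⟨(((x - 1, y), true), 2), by simp [kagomeDart]⟩
    · exact ⟨(((x - 1, y), false), 1), by simp [kagomeDart]⟩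
    · exact ⟨(((x - 1, y - 1), true), 0), by simp [kagomeDart]⟩
    · exact ⟨(((x, y - 1), false), 2), by simp [kagomeDart]⟩

theorem triangularEdgeSite_surjective : Function.Surjective triangularEdgeSite := by
  rintro ⟨⟨x, y⟩, k⟩
  fin_cases k
  · exact ⟨((x + 1, y), 2), by simp [triangularEdgeSite]⟩
  · exact ⟨((x + 1, y), 1), by simp [triangularEdgeSite]⟩
  · exact ⟨((x, y + 1), 0), by simp [triangularEdgeSite]⟩

theorem kagomeDart_ends (e : ((ℤ × ℤ) × Bool) × Fin 3) :
    s(Multigraph.kagomeCorner e.1.1 e.1.2 (e.2 + 1),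
      Multigraph.kagomeCorner e.1.1 e.1.2 (e.2 + 2)) =
      s(triangularEdgeSite (kagomeDart e),
        triangularEdgeSite (triangular.facePerm.symm (kagomeDart e))) := by
  -- Since `facePerm.symm d` is the reverse of `rot.symm d`, both carry the same edge, and
  -- `rot.symm` has an explicit formula.
  have hsymm : triangularEdgeSite (triangular.facePerm.symm (kagomeDart e)) =
      triangularEdgeSite (triangular.rot.symm (kagomeDart e)) := by
    rw [triangularEdgeSite_eq_iff, ← edge_rev]
    congr 1
    rw [Equiv.eq_symm_apply]
    exact triangular.facePerm.apply_symm_apply _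
  rw [hsymm]
  obtain ⟨⟨⟨x, y⟩, b⟩, k⟩ := e
  fin_cases k <;> cases b <;>
    simp [kagomeDart, triangular_rot_symm, triangularEdgeSite, Multigraph.kagomeCorner]

theorem bisectedHexagonal_hasLatticeDual_kagome :
    bisectedHexagonal.HasLatticeDual 12 4 6 Multigraph.kagomeLattice :=
  subdiv_hasLatticeDual_edges triangular_degree triangular_card_face
    (H := Multigraph.kagomeLattice) triangularEdgeSite triangularEdgeSite_eq_iff
    triangularEdgeSite_surjective kagomeDart kagomeDart_bijective kagomeDart_ends

/-! ### The triangular lattice and its sublattice of colour `1` -/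

/-- The three-colouring of the integers by their residues. -/
def residueColour (z : ℤ) : Fin 3 := if z % 3 = 0 then 0 else if z % 3 = 1 then 1 else 2

theorem residueColour_eq_zero {z : ℤ} : residueColour z = 0 ↔ z % 3 = 0 := by
  unfold residueColour
  split_ifs <;> simp <;> omega

theorem residueColour_eq_one {z : ℤ} : residueColour z = 1 ↔ z % 3 = 1 := by
  unfold residueColour
  split_ifs <;> simp <;> omega

theorem residueColour_eq_two {z : ℤ} : residueColour z = 2 ↔ z % 3 = 2 := by
  unfold residueColour
  split_ifs <;> simp <;> omega

theorem residueColour_eq_iff {z w : ℤ} : residueColour z = residueColour w ↔ z % 3 = w % 3 := by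
  unfold residueColour
  split_ifs <;> simp <;> omega

/-- The three-colouring of the triangular lattice. -/
def triangularColour : triangular.Vertex → Fin 3 :=
  Quotient.lift (fun d => residueColour (d.1.1 - d.1.2)) fun _ _ h =>
    Equiv.Perm.SameCycle.apply_eq
      (f := fun d : (ℤ × ℤ) × Fin 6 => residueColour (d.1.1 - d.1.2)) (fun _ => rfl) h

theorem triangularColour_vert (d : (ℤ × ℤ) × Fin 6) :
    triangularColour (triangular.vert d) = residueColour (d.1.1 - d.1.2) := rfl

/-- Every lattice direction changes `x - y` by `±1` or `±2`. -/
theorem triangularColour_isProper : triangular.IsProper triangularColour := by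
  rintro ⟨⟨x, y⟩, k⟩
  rw [triangularColour_vert, triangularColour_vert, Ne, residueColour_eq_iff]
  fin_cases k <;> simp [triangular_rev] <;> omega

/-- Coordinates of the sites of the triangular lattice in the sublattice of colour `1`. -/
def sublatticeSite (d : (ℤ × ℤ) × Fin 6) : ℤ × ℤ :=
  (d.1.2 - 2 * ((1 - (d.1.1 - d.1.2)) / 3), (1 - (d.1.1 - d.1.2)) / 3)

/-- The dart from colour `2` to colour `0` that crosses an edge of the sublattice of
colour `1`. -/
def sublatticeDart (e : (ℤ × ℤ) × Fin 3) : (ℤ × ℤ) × Fin 6 :=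
  ((1 + e.1.1 - e.1.2, e.1.1 + 2 * e.1.2) + ![(1, 0), (-1, 1), (-1, 1)] e.2, ![2, 0, 4] e.2)

theorem sublatticeDart_injective : Function.Injective sublatticeDart := by
  rintro ⟨⟨x, y⟩, k⟩ ⟨⟨x', y'⟩, k'⟩ h
  fin_cases k <;> fin_cases k' <;> simp [sublatticeDart, Fin.ext_iff] at h ⊢ <;> omega

theorem sublatticeDart_range (d : (ℤ × ℤ) × Fin 6) :
    (triangularColour (triangular.vert d) = 2 ∧
      triangularColour (triangular.vert (triangular.rev d)) = 0) ↔
      ∃ e, sublatticeDart e = d := by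
  constructor
  · obtain ⟨⟨x, y⟩, k⟩ := d
    rw [triangularColour_vert, triangularColour_vert, residueColour_eq_two, residueColour_eq_zero]
    rintro ⟨h1, h2⟩
    -- A step from colour `2` to `0` raises `x - y` by `1` modulo `3`, so its direction is `0`, `2`
    -- or `4`. The witness inverts `sublatticeDart` for these; directions `0` and `4` share the
    -- offset `(-1, 1)`, which accounts for the correction by `1`. The entries at odd directions are
    -- fillers.
    refine ⟨((y - ![1, 0, 0, 0, 1, 0] k - 2 * ((2 - (x - y)) / 3 - ![1, 0, 0, 0, 1, 0] k),
      (2 - (x - y)) / 3 - ![1, 0, 0, 0, 1, 0] k), ![1, 0, 0, 0, 2, 0] k), ?_⟩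
    fin_cases k <;> simp [triangular_rev] at h1 h2 <;>
      simp [sublatticeDart] <;> omega
  · rintro ⟨⟨⟨x, y⟩, k⟩, rfl⟩
    rw [triangularColour_vert, triangularColour_vert, residueColour_eq_two, residueColour_eq_zero]
    fin_cases k <;> simp [sublatticeDart, triangular_rev] <;> omega

theorem sublatticeSite_eq_iff (a b : (ℤ × ℤ) × Fin 6)
    (ha : triangularColour (triangular.vert a) = 1)
    (hb : triangularColour (triangular.vert b) = 1) :
    sublatticeSite a = sublatticeSite b ↔ triangular.vert a = triangular.vert b := by
  obtain ⟨⟨x, y⟩, k⟩ := a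
  obtain ⟨⟨x', y'⟩, k'⟩ := b
  rw [triangularColour_vert, residueColour_eq_one] at ha hb
  rw [triangular_vert_eq_iff]
  simp only [sublatticeSite, Prod.mk.injEq] at ha hb ⊢
  omega

theorem exists_sublatticeSite_eq (v : ℤ × ℤ) :
    ∃ d, triangularColour (triangular.vert d) = 1 ∧ sublatticeSite d = v := by
  obtain ⟨x, y⟩ := v
  -- The sublattice of colour `1` is `(1, 0) + x (1, 1) + y (-1, 2)`.
  refine ⟨((1 + x - y, x + 2 * y), 0), ?_, ?_⟩
  · rw [triangularColour_vert, residueColour_eq_one]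
    dsimp only
    omega
  · simp only [sublatticeSite, Prod.mk.injEq]
    omega

theorem sublatticeDart_ends (e : (ℤ × ℤ) × Fin 3) :
    s(e.1, e.1 + ![(1, 0), (0, 1), (-1, 1)] e.2) =
      s(sublatticeSite (triangular.rev (triangular.rot.symm (sublatticeDart e))),
        sublatticeSite (triangular.rev (triangular.rot (sublatticeDart e)))) := by
  obtain ⟨⟨x, y⟩, k⟩ := e
  rw [Sym2.eq_iff]
  fin_cases k <;>
    simp [sublatticeDart, triangular_rot, triangular_rot_symm, triangular_rev,
      sublatticeSite] <;> omega

theorem triangular_hasLatticeDual :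
    triangular.HasLatticeDual 6 6 6 Multigraph.triangularLattice := by
  refine HasLatticeDual.of_darts triangular_isTriangulation triangularColour
    triangularColour_isProper (by decide) (by decide) (by decide) ?_
    (H := Multigraph.triangularLattice) sublatticeSite sublatticeSite_eq_iff
    exists_sublatticeSite_eq sublatticeDart sublatticeDart_injective sublatticeDart_range
    sublatticeDart_ends
  intro v
  rw [triangular_degree]
  generalize triangularColour v = i
  fin_cases i <;> rfl

end CombMap

/-! ### The mapping of the models and its lattice cases -/

theorem corollary4p7 :
    -- the mapping for a finite Eulerian plane triangulation with tripartition `c`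
    (∀ (D : Type*) [Fintype D] (G : CombMap D), G.IsPlane → G.IsTriangulation → G.IsEulerian →
      ∀ c : G.Vertex → Fin 3, G.IsProper c →
      (∀ v, c v = 2 → G.degree v = 4 ∨ G.degree v = 6) →
      -- the dual graph of `G₁₃` has vertex set `V₂`
      (∃ β : {v : G.Vertex // c v = 1} ≃ (G.dualSub (G.edgesBetween c 0 2)).V,
        ∀ (d : D) (hd : c (G.vert d) = 1),
          β ⟨G.vert d, hd⟩ = G.subFace (G.edgesBetween c 0 2) (G.face d)) ∧
      -- the identity of partition functions (the coupling equations force `J ≠ 0`)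
      (∀ (J : ℝ) (L₂ L₂' : ℂ),
        Complex.exp (-2 * L₂) = ((1 / Real.cosh (2 * J) : ℝ) : ℂ) →
        Complex.exp (-2 * L₂') = (Real.tanh (2 * J) : ℂ) →
        Filter.Tendsto ((G.dualSub (G.edgesBetween c 0 2)).preZICLAT L₂ L₂') Filter.atBot
          (nhds ((G.dualSub (G.edgesBetween c 0 2)).ZICLAT L₂ L₂')) ∧
        (G.ZHMBW J : ℂ) =
          (2 : ℂ) ^ (-(Nat.card {v : G.Vertex // c v = 1} : ℤ) + 1)
            * ((2 * Real.cosh (2 * J) : ℝ) : ℂ) ^ Nat.card (G.edgesBetween c 0 2)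
            * (G.dualSub (G.edgesBetween c 0 2)).ZICLAT L₂ L₂') ∧
      -- the case `J = 0`, where `L₂ = 0` and `L₂' = +∞`
      Filter.Tendsto
        (fun L₂' : ℝ => (2 : ℂ) ^ (-(Nat.card {v : G.Vertex // c v = 1} : ℤ) + 1)
          * 2 ^ Nat.card (G.edgesBetween c 0 2)
          * (G.dualSub (G.edgesBetween c 0 2)).ZICLAT 0 L₂')
        Filter.atTop (nhds (G.ZHMBW 0 : ℂ))) ∧
    -- the couplings exist, and are real for positive `J`
    (∀ J : ℝ, J ≠ 0 → ∃ L₂ L₂' : ℂ,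
      Complex.exp (-2 * L₂) = ((1 / Real.cosh (2 * J) : ℝ) : ℂ) ∧
      Complex.exp (-2 * L₂') = (Real.tanh (2 * J) : ℂ)) ∧
    (∀ J : ℝ, 0 < J → ∃! L : ℝ × ℝ,
      Real.exp (-2 * L.1) = 1 / Real.cosh (2 * J) ∧ Real.exp (-2 * L.2) = Real.tanh (2 * J)) ∧
    -- they lie on a circle, and the doubled couplings lie on a line
    (∀ (J : ℝ) (L₂ L₂' : ℂ),
      Complex.exp (-2 * L₂) = ((1 / Real.cosh (2 * J) : ℝ) : ℂ) →
      Complex.exp (-2 * L₂') = (Real.tanh (2 * J) : ℂ) →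
      Complex.exp (-2 * L₂) ^ 2 + Complex.exp (-2 * L₂') ^ 2 = 1 ∧
      Complex.exp (-2 * (2 * L₂)) + Complex.exp (-2 * (2 * L₂')) = 1) ∧
    -- doubling every edge amounts to doubling the couplings
    (∀ (H : Multigraph) [Fintype H.V] [Fintype H.E] (L₂ L₂' : ℂ),
      H.doubled.ZICLAT L₂ L₂' = H.ZICLAT (2 * L₂) (2 * L₂')) ∧
    -- the dual graphs of `G₁₃` for the lattices
    CombMap.triangular.HasLatticeDual 6 6 6 Multigraph.triangularLattice ∧
    CombMap.unionJack.HasLatticeDual 8 8 4 Multigraph.squareLattice.doubled ∧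
    CombMap.bisectedHexagonal.HasLatticeDual 12 6 4 Multigraph.hexagonalLattice.doubled ∧
    CombMap.bisectedHexagonal.HasLatticeDual 6 12 4 Multigraph.triangularLattice.doubled ∧
    CombMap.bisectedHexagonal.HasLatticeDual 12 4 6 Multigraph.kagomeLattice := by
  refine ⟨?_, fun J hJ => exists_complex_couplings hJ, fun J hJ => existsUnique_real_couplings hJ,
    fun J L₂ L₂' h h' => ⟨couplings_circle h h', couplings_line (couplings_circle h h')⟩,
    fun H _ _ L₂ L₂' => H.doubled_ZICLAT L₂ L₂', CombMap.triangular_hasLatticeDual,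
    CombMap.unionJack_hasLatticeDual, CombMap.bisectedHexagonal_hasLatticeDual_hexagonal,
    CombMap.bisectedHexagonal_hasLatticeDual_triangular,
    CombMap.bisectedHexagonal_hasLatticeDual_kagome⟩
  intro D _ G hG hT _ c hc hdeg
  refine ⟨⟨CombMap.starFaceEquiv hc hT, hc.starFace_vert⟩, ?_, ?_⟩
  · intro J L₂ L₂' h h'
    rw [Multigraph.ZICLAT_eq]
    refine ⟨Multigraph.tendsto_preZICLAT _ L₂ L₂', ?_⟩
    rw [h, h']
    exact CombMap.ZHMBW_eq hG hT hc hdeg J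
  · have hlim : Filter.Tendsto (fun L : ℝ => Complex.exp (-2 * L)) Filter.atTop (nhds 0) := by
      refine Complex.tendsto_exp_comap_re_atBot.comp (Filter.tendsto_comap_iff.2 ?_)
      have : (Complex.re ∘ fun L : ℝ => -2 * (L : ℂ)) = fun L : ℝ => -2 * L := by
        funext L
        simp
      rw [this]
      exact Filter.tendsto_id.const_mul_atTop_of_neg (by norm_num)
    -- At `J = 0` the polynomial identity holds with weights `1` and `0`. The limit `L₂' → +∞`
    -- approaches the weight `0`, and continuity of the polynomial concludes.
    have hZ := CombMap.ZHMBW_eq hG hT hc hdeg 0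
    simp only [mul_zero, Real.cosh_zero, Real.tanh_zero, mul_one, div_one, Complex.ofReal_one,
      Complex.ofReal_zero, Complex.ofReal_ofNat] at hZ
    rw [hZ]
    simp_rw [Multigraph.ZICLAT_eq, mul_zero, Complex.exp_zero]
    exact (((G.dualSub (G.edgesBetween c 0 2)).continuous_polyICLAT 1).tendsto 0 |>.comp
      hlim).const_mul _
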